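/- Let $\mathbf{k}$ be a commutative unitary ring containing $\mathbb{Q}$, and let $X=\{x_i : i\ge 1\}$ be commuting variables. A weak composition is a finite (possibly empty) sequence of nonnegative integers. For $\alpha=(\alpha_1,\dots,\alpha_n)$ a weak composition and $\beta=(\beta_1,\dots,\beta_n)$ a sequence of positive integers, let $\phi\binom{\alpha}{\beta}\in\mathbf{k}[[X]][t][z^{-1},z]]$ be the Laurent expansion at $z=0$, taken coefficientwise in the monomials in $X$, of $$\sum_{1\le i_1<\cdots<i_n} x_{i_1}^{\alpha_1}\cdots x_{i_n}^{\alpha_n}\,e^{(i_1+t)\beta_1 z}\cdots e^{(i_n+t)\beta_n z}\qquad (t\ge 0,\ \mathrm{Re}\,z<0),$$ whose coefficients lie in $\mathbb{Q}[[X]][t]$. Let $P$ be the projection of a Laurent series in $z$ onto its polar part $\sum_{m<0}a_mz^m$. Let $\phi_-,\phi_+$ be the components of the Algebraic Birkhoff Factorization of $\phi$, i.e. $\phi_\pm(\emptyset)=1$ and, for $n\ge 1$ and with $w=\binom{\alpha}{\beta}$, $w_{\le i}=\binom{\alpha_1,\dots,\alpha_i}{\beta_1,\dots,\beta_i}$,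 $w_{>i}=\binom{\alpha_{i+1},\dots,\alpha_n}{\beta_{i+1},\dots,\beta_n}$, $$\phi_-(w)=-P\Big(\phi(w)+\sum_{i=1}^{n-1}\phi(w_{\le i})\phi_-(w_{>i})\Big),\qquad \phi_+(w)=(\mathrm{id}-P)\Big(\phi(w)+\sum_{i=1}^{n-1}\phi(w_{\le i})\phi_-(w_{>i})\Big).$$ For a positive integer $\delta$, the renormalized monomial quasisymmetric function of a weak composition $\alpha$ of length $n$ is $$M_\alpha:=\phi_+\binom{\alpha_1,\dots,\alpha_n}{\delta,\dots,\delta}\Big|_{z=0}\in\mathbf{k}[[X]][t],$$ and $\mathrm{RenQSym}$ is the set of all $\mathbf{k}$-linear combinations of the $M_\alpha$, $\alpha$ ranging over all weak compositions. Let $*$ be the quasi-shuffle (stuffle) product on the free $\mathbf{k}$-module on weak compositions: $\emptyset$ is its identity, it is bilinear, and $$(a,\alpha')*(b,\beta')=(a,\alpha'*(b,\beta'))+(b,(a,\alpha')*\beta')+(a+b,\alpha'*\beta').$$ Extend $\alpha\mapsto M_\alpha$ linearly to this module. Then $M_\alpha$ does not depend on the choice of $\delta$, and $$M_\alpha M_\beta=M_{\alpha*\beta}$$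 for all weak compositions $\alpha,\beta$. Consequently $\mathrm{RenQSym}$ is a $\mathbf{k}$-subalgebra of $\mathbf{k}[[X]][t]$. -/

import Mathlib

open Filter Topology

noncomputable section

namespace RenQuasiSym

/-! ### Quasi-shuffle product -/

/-- The quasi-shuffle (stuffle) product `a * b` of two words over an additive semigroup `A`, an
element of the free `k`-module on words:
`a * b = (a₁, a' * b) + (b₁, a * b') + (a₁ + b₁, a' * b')`, with the empty word as identity. -/
def quasiShuffle (k : Type*) [CommRing k] {A : Type*} [Add A] :
    List A → List A → (List A →₀ k)
  | [], b => Finsupp.single b 1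
  | x :: a, [] => Finsupp.single (x :: a) 1
  | x :: a, y :: b =>
      (quasiShuffle k a (y :: b)).mapDomain (List.cons x)
        + (quasiShuffle k (x :: a) b).mapDomain (List.cons y)
        + (quasiShuffle k a b).mapDomain (List.cons (x + y))
termination_by a b => a.length + b.length

/-! ### The regularization map

A weak composition is a list of natural numbers; a directed weak composition `(α, β)`
(`α ∈ ℕ^n`, `β ∈ ℙ^n`) is a list of pairs in `ℕ × ℕ+`. The variables are `x_i`, `i : ℕ+`. -/

/-- The ring `k[[X]][t]`. -/
abbrev PolyT (k : Type*) [CommRing k] : Type _ := Polynomial (MvPowerSeries ℕ+ k)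

/-- The ring `k[[X]][t][z⁻¹, z]]` of Laurent series in `z`. -/
abbrev LaurentT (k : Type*) [CommRing k] : Type _ := LaurentSeries (PolyT k)

/-- The summand
`x_{i₁}^{α₁} ⋯ x_{iₙ}^{αₙ} e^{(i₁+t)β₁z} ⋯ e^{(iₙ+t)βₙz}`
of the regularized sum, for an index sequence `i₁ < ⋯ < iₙ` of positive integers. -/
def regTerm (w : List (ℕ × ℕ+)) (t : ℝ) (z : ℂ) (i : Fin w.length ↪o ℕ+) :
    MvPowerSeries ℕ+ ℂ :=
  MvPowerSeries.monomial (∑ l, Finsupp.single (i l) (w.get l).1)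
    (∏ l, Complex.exp (((((i l : ℕ+) : ℕ) : ℂ) + (t : ℂ)) * (((w.get l).2 : ℕ) : ℂ) * z))

/-- The value at `t` of the coefficient of `zⁿ x^m` in an element of `ℚ[[X]][t][z⁻¹, z]]`. -/
def coeffAt (F : LaurentT ℚ) (n : ℤ) (m : ℕ+ →₀ ℕ) (t : ℝ) : ℂ :=
  (F.coeff n).sum fun s a => ((MvPowerSeries.coeff m a : ℚ) : ℂ) * (t : ℂ) ^ s

/-- `F` is the Laurent expansion at `z = 0` of the regularized sum
`∑_{i₁ < ⋯ < iₙ} x_{i₁}^{α₁} ⋯ x_{iₙ}^{αₙ} e^{(i₁+t)β₁z} ⋯ e^{(iₙ+t)βₙz}` (`t ≥ 0`, `Re z < 0`):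
for every monomial `x^m`, the coefficients of `x^m` in the summands are (absolutely) summable, and
for `z` near `0` their sum is given by the convergent Laurent series of the coefficient of
`x^m` in `F`. -/
def IsRegularization (w : List (ℕ × ℕ+)) (F : LaurentT ℚ) : Prop :=
  ∀ (m : ℕ+ →₀ ℕ) (t : ℝ), 0 ≤ t →
    (∀ z : ℂ, z.re < 0 → Summable fun i => MvPowerSeries.coeff m (regTerm w t z i)) ∧
    ∀ᶠ z : ℂ in 𝓝[{z : ℂ | z.re < 0}] 0,
      HasSum (fun n : ℤ => coeffAt F n m t * z ^ n)
        (∑' i, MvPowerSeries.coeff m (regTerm w t z i))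

/-- The regularization over `ℚ`: the (unique) element of `ℚ[[X]][t][z⁻¹, z]]` that is the Laurent
expansion of the regularized sum. -/
def regularizationRat (w : List (ℕ × ℕ+)) : LaurentT ℚ :=
  Classical.epsilon (IsRegularization w)

/-- The regularization map `φ` on directed weak compositions, with values in
`k[[X]][t][z⁻¹, z]]` for a commutative ring `k` containing `ℚ`. -/
def regularization (k : Type*) [CommRing k] [Algebra ℚ k] (w : List (ℕ × ℕ+)) : LaurentT k :=
  (regularizationRat w).map (Polynomial.mapRingHom (MvPowerSeries.map (algebraMap ℚ k)))

/-! ### Algebraic Birkhoff factorization of the regularization map -/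

/-- The projection of a Laurent series onto its polar part `∑_{n < 0} aₙ zⁿ`. -/
def polarPart {k : Type*} [CommRing k] (F : LaurentT k) : LaurentT k :=
  HahnSeries.truncLT (0 : ℤ) F

/-- The component `φ₋` of the Algebraic Birkhoff Factorization `φ = φ₊ ⋆ φ₋^{⋆(-1)}`:
`φ₋(w) = -P(φ(w) + ∑_{0 < i < n} φ(w₁,…,wᵢ) φ₋(wᵢ₊₁,…,wₙ))` for a nonempty word `w`
of length `n`. -/
def phiMinus (k : Type*) [CommRing k] [Algebra ℚ k] : List (ℕ × ℕ+) → LaurentT k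
  | [] => 1
  | a :: w =>
      -polarPart (regularization k (a :: w)
        + ∑ i : Fin w.length, regularization k (a :: w.take i) * phiMinus k (w.drop i))
termination_by w => w.length
decreasing_by simp

/-- The component `φ₊` (the renormalization of `φ`):
`φ₊(w) = (id - P)(φ(w) + ∑_{0 < i < n} φ(w₁,…,wᵢ) φ₋(wᵢ₊₁,…,wₙ))` for a nonempty word `w`
of length `n`. -/
def phiPlus (k : Type*) [CommRing k] [Algebra ℚ k] : List (ℕ × ℕ+) → LaurentT k
  | [] => 1
  | a :: w =>
      let F := regularization k (a :: w)
        + ∑ i : Fin w.length, regularization k (a :: w.take i) * phiMinus k (w.drop i)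
      F - polarPart F

/-- The directional quasisymmetric function `Z(α, β) = φ₊(α, β)|_{z = 0}`. -/
def dirQSym (k : Type*) [CommRing k] [Algebra ℚ k] (w : List (ℕ × ℕ+)) : PolyT k :=
  (phiPlus k w).coeff 0

/-! ### Renormalized quasisymmetric functions -/

/-- The renormalized monomial quasisymmetric function `M_α = Z(α, (δ, …, δ))` of a weak
composition `α`, where `δ` is a positive integer. -/
def renM (k : Type*) [CommRing k] [Algebra ℚ k] (δ : ℕ+) (α : List ℕ) : PolyT k :=
  dirQSym k (α.map fun a => (a, δ))

/-- The `k`-module `RenQSym` of renormalized quasisymmetric functions: the `k`-linear combinations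
of the `M_α`. -/
def renQSym (k : Type*) [CommRing k] [Algebra ℚ k] (δ : ℕ+) : Submodule k (PolyT k) :=
  Submodule.span k (Set.range (renM k δ))

end RenQuasiSym

end

/-!
The expansion of the regularized sum can be computed explicitly for words with a constant direction
`δ`, and the theorem follows from the resulting formula for `M_α`.

Fix `N` and set `x_i = 0` for `i > N`. Sums over the indices above `N` then vanish unless
`α = (0, …, 0)`, and for `p` zeros the sum is the `p`-th elementary symmetric function of the
numbers `e^{(j + t)δz}`, `j > N`. These form a geometric progression, whose power sums
`e^{k(N + 1 + t)δz} / (1 - e^{kδz})` are generating functions of Bernoulli polynomials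
(`eq_newton_of_qRecursion`, `hasSum_bernoulli_near_zero`). The indices `N, …, 1` are added one
at a time by the operation `step`, with weights `x_i^a e^{(i + t)δz}` that are holomorphic in `z`
(`shiftSum_cons`). This yields a formal model `formalReg` of the regularization
(`truncLaurent_regularizationRat`); a bound on poles and degrees in `t` shows that the
truncations come from one element of `ℚ[[X]][t][z⁻¹, z]]`.

The `k`-th power sum is the sum of the pole `-1 / (kδz)`, which depends neither on `t` nor on `N`,
and of a power series in `z` with constant term `-(t + N + 1/2)`. In terms of generating functions
in an auxiliary variable `y`, elementary symmetric functions are exponentials of power sums, so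
splitting off the pole is a Birkhoff factorization: `φ₋` is the exponential of the negatives of the
poles on words `(0, …, 0)` and vanishes on the other words. Convolution with `φ₋` commutes with
`step` (`conv_step`), hence `φ₊ = φ ⋆ φ₋` is holomorphic on all words
(`conv_formalReg_counterterm`, `phiMinus_word`, `phiPlus_word`).

At `z = 0` the weights become `x_i^a` and the word of `p` zeros contributes the binomial
coefficient of `-(t + N + 1/2)` over `p`; the direction `δ` has disappeared, which is the first
claim. For the second, binomial coefficients form a character of the quasi-shuffle algebra
(`isStuffleChar_onZeros`), and `step` with a weight multiplicative in the letter preserves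
characters (`IsStuffleChar.step`). All identities are checked modulo `x_i`, `i > N`, for every `N`,
over `ℚ`, and then transported to `k`.
-/

noncomputable section

namespace RenQuasiSym

open Polynomial (aeval)

/-! ### Elementary symmetric functions from power sums -/

/-- The elementary symmetric functions expressed through power sums: if `P k` is the `k`-th
power sum of some variables, then `newton P p` is their `p`-th elementary symmetric function,
computed by Newton's identities. The value `P 0` is not used. -/
def newton {R : Type*} [CommRing R] [Algebra ℚ R] (P : ℕ → R) : ℕ → R
  | 0 => 1
  | p + 1 => ((p : ℚ) + 1)⁻¹ •
      ∑ i : Fin (p + 1), (-1) ^ (i : ℕ) * P (i + 1) * newton P (p - i)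

section Newton

variable {R S : Type*} [CommRing R] [Algebra ℚ R] [CommRing S] [Algebra ℚ S]

theorem newton_zero (P : ℕ → R) : newton P 0 = 1 := by rw [newton]

theorem newton_succ (P : ℕ → R) (p : ℕ) :
    newton P (p + 1) = ((p : ℚ) + 1)⁻¹ •
      ∑ ij ∈ Finset.HasAntidiagonal.antidiagonal p, (-1) ^ ij.1 * P (ij.1 + 1) * newton P ij.2 := by
  rw [newton, Finset.Nat.sum_antidiagonal_eq_sum_range_succ
    (fun i j => (-1) ^ i * P (i + 1) * newton P j), Finset.sum_range]

/-- The recursion with the rational scalar written through an arbitrary ring homomorphism from `ℚ`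
(there is only one). -/
theorem newton_succ_mul (φ : ℚ →+* R) (P : ℕ → R) (p : ℕ) :
    newton P (p + 1) = φ ((p : ℚ) + 1)⁻¹ *
      ∑ ij ∈ Finset.HasAntidiagonal.antidiagonal p,
        (-1) ^ ij.1 * P (ij.1 + 1) * newton P ij.2 := by
  rw [newton_succ, Algebra.smul_def, Subsingleton.elim φ (algebraMap ℚ R)]

/-- A sequence satisfying Newton's identities is determined by the power sums. -/
theorem eq_newton {P f : ℕ → R} (h0 : f 0 = 1)
    (h : ∀ p : ℕ, ((p : R) + 1) * f (p + 1) =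
      ∑ ij ∈ Finset.HasAntidiagonal.antidiagonal p, (-1) ^ ij.1 * P (ij.1 + 1) * f ij.2) (p : ℕ) :
    f p = newton P p := by
  induction p using Nat.strong_induction_on with
  | _ p ih =>
    cases p with
    | zero => rw [h0, newton_zero]
    | succ p =>
      have hp : ((p : ℚ) + 1) ≠ 0 := by positivity
      have h1 : f (p + 1) = ((p : ℚ) + 1)⁻¹ • (((p : R) + 1) * f (p + 1)) := by
        have : ((p : R) + 1) = algebraMap ℚ R ((p : ℚ) + 1) := by simp
        rw [this, ← Algebra.smul_def, smul_smul, inv_mul_cancel₀ hp, one_smul]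
      rw [h1, h, newton_succ]
      congr 1
      refine Finset.sum_congr rfl fun ij hij => ?_
      rw [ih ij.2 (Nat.lt_succ_of_le (Finset.HasAntidiagonal.antidiagonal.snd_le hij))]

theorem map_newton (f : R →+* S) (P : ℕ → R) (p : ℕ) :
    f (newton P p) = newton (fun k => f (P k)) p := by
  induction p using Nat.strong_induction_on with
  | _ p ih =>
    cases p with
    | zero => simp [newton_zero]
    | succ p =>
      rw [newton_succ, newton_succ, map_rat_smul, map_sum]
      congr 1
      refine Finset.sum_congr rfl fun ij hij => ?_
      rw [map_mul, map_mul, ih ij.2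
        (Nat.lt_succ_of_le (Finset.HasAntidiagonal.antidiagonal.snd_le hij))]
      simp

/-- The generating function `∑ (-1) ^ k P (k + 1) yᵏ` of the power sums, which is the logarithmic
derivative of the generating function of the elementary symmetric functions. -/
def powerSumSeries (P : ℕ → R) : PowerSeries R := PowerSeries.mk fun k => (-1) ^ k * P (k + 1)

theorem derivative_mk_newton (P : ℕ → R) :
    PowerSeries.derivative R (PowerSeries.mk (newton P)) =
      powerSumSeries P * PowerSeries.mk (newton P) := by
  ext p
  have hp : ((p : ℚ) + 1) ≠ 0 := by positivity
  have h2 : ((p : R) + 1) = algebraMap ℚ R ((p : ℚ) + 1) := by simp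
  rw [PowerSeries.coeff_derivative, PowerSeries.coeff_mk, newton_succ, mul_comm, h2,
    ← Algebra.smul_def, smul_smul, mul_inv_cancel₀ hp, one_smul, PowerSeries.coeff_mul]
  simp [powerSumSeries]

theorem mk_eq_mk_newton {P : ℕ → R} {F : PowerSeries R} (h0 : PowerSeries.coeff 0 F = 1)
    (h : PowerSeries.derivative R F = powerSumSeries P * F) : F = PowerSeries.mk (newton P) := by
  ext p
  rw [PowerSeries.coeff_mk]
  refine eq_newton (f := fun p => PowerSeries.coeff p F) h0 (fun p => ?_) p
  have := congrArg (PowerSeries.coeff p) h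
  rw [PowerSeries.coeff_derivative, PowerSeries.coeff_mul] at this
  rw [mul_comm, this]
  simp [powerSumSeries]

/-- Elementary symmetric functions of a disjoint union of alphabets: power sums add, and the
generating functions `∑ newton P p yᵖ = exp (∑ (-1) ^ (k - 1) P k yᵏ / k)` multiply. -/
theorem newton_add (P P' : ℕ → R) (p : ℕ) :
    newton (fun k => P k + P' k) p =
      ∑ ij ∈ Finset.HasAntidiagonal.antidiagonal p, newton P ij.1 * newton P' ij.2 := by
  have key : PowerSeries.mk (newton P) * PowerSeries.mk (newton P') =
      PowerSeries.mk (newton fun k => P k + P' k) := by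
    apply mk_eq_mk_newton
    · simp [newton_zero]
    · rw [Derivation.leibniz, derivative_mk_newton, derivative_mk_newton]
      have : powerSumSeries (fun k => P k + P' k) = powerSumSeries P + powerSumSeries P' := by
        ext k; simp [powerSumSeries, mul_add]
      rw [this]
      simp only [smul_eq_mul]
      ring
  have := congrArg (PowerSeries.coeff p) key
  rw [PowerSeries.coeff_mul, PowerSeries.coeff_mk] at this
  simpa using this.symm

/-- A single variable equal to `1`. -/
theorem newton_one (p : ℕ) : newton (fun _ => (1 : R)) p = if p ≤ 1 then 1 else 0 := by
  symm
  refine eq_newton (f := fun p => if p ≤ 1 then (1 : R) else 0) (by simp) (fun p => ?_) p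
  cases p with
  | zero => simp
  | succ p =>
    rw [if_neg (by omega), mul_zero, Finset.Nat.sum_antidiagonal_eq_sum_range_succ_mk,
      Finset.sum_range_succ, Finset.sum_range_succ, Finset.sum_eq_zero]
    · simp [pow_succ]
    · intro i hi
      rw [Finset.mem_range] at hi
      simp; omega

theorem newton_zero_const (p : ℕ) : newton (fun _ => (0 : R)) p = if p = 0 then 1 else 0 := by
  cases p with
  | zero => simp [newton_zero]
  | succ p => simp [newton_succ]

/-- Pascal's rule: for a constant sequence of power sums `c`, `newton _ p` is the binomial
coefficient `c` choose `p`. -/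
theorem newton_add_one (c : R) (p : ℕ) :
    newton (fun _ => c + 1) (p + 1) = newton (fun _ => c) (p + 1) + newton (fun _ => c) p := by
  rw [newton_add (fun _ => c) (fun _ => 1), Finset.Nat.sum_antidiagonal_succ']
  rw [newton_zero, mul_one]
  congr 1
  cases p with
  | zero => simp [newton_one]
  | succ p =>
    rw [Finset.Nat.sum_antidiagonal_succ', Finset.sum_eq_zero]
    · simp [newton_one]
    · intro ij hij
      simp [newton_one]

/-- Newton's identities for the alphabet `a, aq, aq², …`. Its power sums are `aᵏ / (1 - qᵏ)`, and
its elementary symmetric functions are determined by the functional equation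
`E(y) = (1 + ay) E(qy)` of the generating function `E`, which is the hypothesis `h`. -/
theorem eq_newton_of_qRecursion {K : Type*} [Field K] [Algebra ℚ K] {q a : K} {e : ℕ → K}
    (hq : ∀ k : ℕ, 1 - q ^ (k + 1) ≠ 0) (h0 : e 0 = 1)
    (h : ∀ p, e (p + 1) * (1 - q ^ (p + 1)) = a * q ^ p * e p) (p : ℕ) :
    e p = newton (fun k => a ^ k / (1 - q ^ k)) p := by
  set P : ℕ → K := fun k => a ^ k / (1 - q ^ k) with hP
  set E : PowerSeries K := PowerSeries.mk e with hE
  set A : PowerSeries K := 1 + PowerSeries.C a * PowerSeries.X with hA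
  set r := PowerSeries.rescale q with hr
  set Γ : PowerSeries K := PowerSeries.mk fun k => (-1) ^ k * a ^ (k + 1) with hΓ
  have hcA : ∀ (F : PowerSeries K) (p : ℕ), PowerSeries.coeff (p + 1) (A * F) =
      PowerSeries.coeff (p + 1) F + a * PowerSeries.coeff p F := by
    intro F p
    rw [hA, add_mul, one_mul, map_add, mul_assoc, PowerSeries.coeff_C_mul,
      PowerSeries.coeff_succ_X_mul]
  have hcA0 : ∀ (F : PowerSeries K), PowerSeries.coeff 0 (A * F) = PowerSeries.coeff 0 F := by
    intro F
    rw [hA, add_mul, one_mul, map_add, mul_assoc, PowerSeries.coeff_C_mul,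
      PowerSeries.coeff_zero_X_mul, mul_zero, add_zero]
  have hEA : E = A * r E := by
    ext p
    cases p with
    | zero => rw [hcA0]; simp [hE, hr]
    | succ p =>
      rw [hcA]
      simp only [hE, hr, PowerSeries.coeff_rescale, PowerSeries.coeff_mk]
      linear_combination h p
  have hL : powerSumSeries P = PowerSeries.C q * r (powerSumSeries P) + Γ := by
    ext k
    have := hq k
    simp only [map_add, PowerSeries.coeff_C_mul, hr, PowerSeries.coeff_rescale, powerSumSeries,
      PowerSeries.coeff_mk, hP, hΓ]
    field_simp
    ring
  have hAΓ : A * Γ = PowerSeries.C a := by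
    ext k
    cases k with
    | zero => rw [hcA0]; simp [hΓ]
    | succ k =>
      rw [hcA]
      simp only [hΓ, PowerSeries.coeff_mk, PowerSeries.coeff_C]
      rw [if_neg (by omega)]
      ring
  have hdr : PowerSeries.derivative K (r E) = PowerSeries.C q * r (PowerSeries.derivative K E) := by
    ext k
    simp only [PowerSeries.coeff_derivative, hr, PowerSeries.coeff_rescale,
      PowerSeries.coeff_C_mul]
    ring
  have hdA : PowerSeries.derivative K A = PowerSeries.C a := by
    ext k
    cases k <;> simp [hA, PowerSeries.coeff_C]
  -- `G` measures the failure of Newton's identities, and satisfies a linear `q`-recursion.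
  set G := PowerSeries.derivative K E - powerSumSeries P * E with hG
  have hGr : G = A * (PowerSeries.C q * r G) := by
    have h1 : PowerSeries.derivative K E =
        PowerSeries.C a * r E + A * (PowerSeries.C q * r (PowerSeries.derivative K E)) := by
      conv_lhs => rw [hEA]
      rw [Derivation.leibniz, hdA, hdr]
      simp only [smul_eq_mul]
      ring
    have h2 : powerSumSeries P * E = A * (PowerSeries.C q * r (powerSumSeries P * E)) +
        PowerSeries.C a * r E := by
      conv_lhs => rw [hL, hEA]
      rw [map_mul]
      linear_combination (r E) * hAΓ
    rw [hG, map_sub]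
    conv_lhs => rw [h1, h2]
    ring
  have hG0 : G = 0 := by
    ext p
    induction p with
    | zero =>
      have := congrArg (PowerSeries.coeff 0) hGr
      rw [hcA0, PowerSeries.coeff_C_mul, hr, PowerSeries.coeff_rescale] at this
      have h3 : PowerSeries.coeff 0 G * (1 - q ^ (0 + 1)) = 0 := by linear_combination this
      simpa using (mul_eq_zero.1 h3).resolve_right (hq 0)
    | succ p ih =>
      have := congrArg (PowerSeries.coeff (p + 1)) hGr
      rw [hcA, PowerSeries.coeff_C_mul, PowerSeries.coeff_C_mul, hr, PowerSeries.coeff_rescale,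
        PowerSeries.coeff_rescale, ih] at this
      have h3 : PowerSeries.coeff (p + 1) G * (1 - q ^ (p + 1 + 1)) = 0 := by
        simp only [map_zero] at this
        linear_combination this
      simpa using (mul_eq_zero.1 h3).resolve_right (hq (p + 1))
  have := mk_eq_mk_newton (P := P) (F := E) (by simp [hE, h0]) (sub_eq_zero.1 hG0)
  simpa [hE] using congrArg (PowerSeries.coeff p) this

end Newton

/-! ### Quasi-shuffle characters -/

section Words

variable {A R S : Type*} [CommRing R] [CommRing S]

/-- The value at `a * b` (quasi-shuffle product) of the linear extension of a function `f` on
words. -/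
def stuffleEval [Add A] (f : List A → R) : List A → List A → R
  | [], b => f b
  | x :: a, [] => f (x :: a)
  | x :: a, y :: b =>
      stuffleEval (fun w => f (x :: w)) a (y :: b) + stuffleEval (fun w => f (y :: w)) (x :: a) b
        + stuffleEval (fun w => f ((x + y) :: w)) a b
termination_by a b => a.length + b.length

theorem linearCombination_quasiShuffle (k : Type*) [CommRing k] [Algebra k R] [Add A]
    (a b : List A) : ∀ f : List A → R,
    Finsupp.linearCombination k f (quasiShuffle k a b) = stuffleEval f a b := by
  induction a, b using quasiShuffle.induct with
  | case1 b => intro f; simp [quasiShuffle, stuffleEval]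
  | case2 x a => intro f; simp [quasiShuffle, stuffleEval]
  | case3 x a y b h1 h2 h3 =>
    intro f
    rw [quasiShuffle, stuffleEval, map_add, map_add, Finsupp.linearCombination_mapDomain,
      Finsupp.linearCombination_mapDomain, Finsupp.linearCombination_mapDomain]
    rw [← h1, ← h2, ← h3]
    rfl

theorem map_stuffleEval [Add A] (ρ : R →+* S) (a b : List A) : ∀ f : List A → R,
    ρ (stuffleEval f a b) = stuffleEval (fun w => ρ (f w)) a b := by
  induction a, b using quasiShuffle.induct with
  | case1 b => intro f; simp [stuffleEval]
  | case2 x a => intro f; simp [stuffleEval]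
  | case3 x a y b h1 h2 h3 =>
    intro f
    rw [stuffleEval, stuffleEval, map_add, map_add, h1, h2, h3]

theorem stuffleEval_add [Add A] (a b : List A) : ∀ f g : List A → R,
    stuffleEval (fun w => f w + g w) a b = stuffleEval f a b + stuffleEval g a b := by
  induction a, b using quasiShuffle.induct with
  | case1 b => intro f g; simp [stuffleEval]
  | case2 x a => intro f g; simp [stuffleEval]
  | case3 x a y b h1 h2 h3 =>
    intro f g
    simp only [stuffleEval, h1, h2, h3]
    ring

theorem stuffleEval_mul [Add A] (c : R) (a b : List A) : ∀ f : List A → R,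
    stuffleEval (fun w => c * f w) a b = c * stuffleEval f a b := by
  induction a, b using quasiShuffle.induct with
  | case1 b => intro f; simp [stuffleEval]
  | case2 x a => intro f; simp [stuffleEval]
  | case3 x a y b h1 h2 h3 =>
    intro f
    simp only [stuffleEval, h1, h2, h3]
    ring

/-- A character of the quasi-shuffle algebra: a function on words whose linear extension is
unital and multiplicative. -/
structure IsStuffleChar [Add A] (f : List A → R) : Prop where
  nil : f [] = 1
  mul : ∀ a b, f a * f b = stuffleEval f a b

theorem IsStuffleChar.map [Add A] {f : List A → R} (hf : IsStuffleChar f) (ρ : R →+* S) :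
    IsStuffleChar fun w => ρ (f w) :=
  ⟨by simp [hf.nil], fun a b => by rw [← map_mul, hf.mul, map_stuffleEval]⟩

/-- `step x f` prepends one further index to the nested sums `f`: with `f` a sum over
`i₁ < ⋯ < iₙ` of indices above some `N + 1`, and `x a` the weight of the letter `a` at the index
`N + 1`, this is the sum over the indices above `N`, split according to whether `i₁ = N + 1`. -/
def step (x : A → R) (f : List A → R) : List A → R
  | [] => f []
  | a :: w => f (a :: w) + x a * f w

theorem map_step (ρ : R →+* S) (x : A → R) (f : List A → R) (w : List A) :
    ρ (step x f w) = step (fun a => ρ (x a)) (fun w => ρ (f w)) w := by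
  cases w <;> simp [step]

/-- Adding an index preserves quasi-shuffle characters, provided the weight is multiplicative in
the letter. -/
theorem IsStuffleChar.step [Add A] {f : List A → R} (hf : IsStuffleChar f) {x : A → R}
    (hx : ∀ a b, x (a + b) = x a * x b) : IsStuffleChar (step x f) := by
  refine ⟨hf.nil, fun a b => ?_⟩
  match a, b with
  | [], b => simp [RenQuasiSym.step, hf.nil, stuffleEval]
  | a :: w, [] => simp [RenQuasiSym.step, hf.nil, stuffleEval]
  | a :: w, b :: v =>
    have h1 := hf.mul (a :: w) (b :: v)
    have h2 := hf.mul w (b :: v)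
    have h3 := hf.mul (a :: w) v
    have h4 := hf.mul w v
    rw [stuffleEval] at h1
    simp only [RenQuasiSym.step, stuffleEval, stuffleEval_add, stuffleEval_mul, ← h2, ← h3, ← h4,
      hx]
    linear_combination h1

/-- `tower x f d N` starts from the nested sums `f (N + d)` over the indices above `N + d`, and
adds the indices `N + d, …, N + 1` one by one. -/
def tower (x : ℕ → A → R) (f : ℕ → List A → R) : ℕ → ℕ → List A → R
  | 0, N => f N
  | d + 1, N => step (x N) (tower x f d (N + 1))

theorem map_tower (ρ : R →+* S) (x : ℕ → A → R) (f : ℕ → List A → R) (d : ℕ) :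
    ∀ (N : ℕ) (w : List A), ρ (tower x f d N w) =
      tower (fun N a => ρ (x N a)) (fun N w => ρ (f N w)) d N w := by
  induction d with
  | zero => intro N w; rfl
  | succ d ih =>
    intro N w
    rw [tower, map_step, tower]
    congr 1
    funext w
    exact ih _ _

theorem IsStuffleChar.tower [Add A] {f : ℕ → List A → R} {x : ℕ → A → R}
    (hx : ∀ N a b, x N (a + b) = x N a * x N b) (d : ℕ) :
    ∀ N : ℕ, IsStuffleChar (f (N + d)) → IsStuffleChar (tower x f d N) := by
  induction d with
  | zero => intro N h; exact h
  | succ d ih =>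
    intro N h
    exact (ih (N + 1) (by rwa [show N + 1 + d = N + (d + 1) by omega])).step (hx N)

/-- The convolution product for the deconcatenation coproduct on words. -/
def conv (f g : List A → R) (w : List A) : R :=
  ∑ i ∈ Finset.range (w.length + 1), f (w.take i) * g (w.drop i)

theorem conv_cons (f g : List A → R) (a : A) (w : List A) :
    conv f g (a :: w) = f [] * g (a :: w) + conv (fun v => f (a :: v)) g w := by
  rw [conv, List.length_cons, Finset.sum_range_succ', add_comm]
  simp [conv]

theorem conv_step (x : A → R) (f g : List A → R) : conv (step x f) g = step x (conv f g) := by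
  funext w
  cases w with
  | nil => simp [conv, step]
  | cons a w =>
    rw [conv_cons]
    simp only [step]
    rw [conv_cons]
    simp only [conv, add_mul, Finset.sum_add_distrib, mul_assoc, ← Finset.mul_sum]
    ring

theorem conv_tower (x : ℕ → A → R) (f : ℕ → List A → R) (g : List A → R) (d : ℕ) :
    ∀ N, conv (tower x f d N) g = tower x (fun N => conv (f N) g) d N := by
  induction d with
  | zero => intro N; rfl
  | succ d ih => intro N; rw [tower, conv_step, ih, tower]

theorem map_conv (ρ : R →+* S) (f g : List A → R) (w : List A) :
    ρ (conv f g w) = conv (fun w => ρ (f w)) (fun w => ρ (g w)) w := by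
  simp [conv]

/-- The function on weak compositions supported on the words `(0, …, 0)`, with value `c p` at the
word of length `p`. -/
def onZeros (c : ℕ → R) (w : List ℕ) : R := if ∀ a ∈ w, a = 0 then c w.length else 0

theorem map_onZeros (ρ : R →+* S) (c : ℕ → R) (w : List ℕ) :
    ρ (onZeros c w) = onZeros (fun p => ρ (c p)) w := by
  unfold onZeros; split_ifs <;> simp

theorem conv_onZeros (c d : ℕ → R) (w : List ℕ) :
    conv (onZeros c) (onZeros d) w =
      onZeros (fun p => ∑ ij ∈ Finset.HasAntidiagonal.antidiagonal p, c ij.1 * d ij.2) w := by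
  by_cases h : ∀ a ∈ w, a = 0
  · rw [onZeros, if_pos h, conv, Finset.Nat.sum_antidiagonal_eq_sum_range_succ
      (fun i j => c i * d j)]
    refine Finset.sum_congr rfl fun i hi => ?_
    rw [Finset.mem_range] at hi
    rw [onZeros, if_pos fun a ha => h a (List.mem_of_mem_take ha), onZeros,
      if_pos fun a ha => h a (List.mem_of_mem_drop ha), List.length_take, List.length_drop,
      min_eq_left (by omega)]
  · rw [onZeros, if_neg h, conv]
    refine Finset.sum_eq_zero fun i _ => ?_
    by_cases h1 : ∀ a ∈ w.take i, a = 0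
    · have h2 : ¬ ∀ a ∈ w.drop i, a = 0 := fun h2 => h fun a ha => by
        rw [← List.take_append_drop i w, List.mem_append] at ha
        exact ha.elim (h1 a) (h2 a)
      rw [onZeros, onZeros, if_neg h2, mul_zero]
    · rw [onZeros, if_neg h1, zero_mul]

/-- The function sending `(0, …, 0)` (`p` zeros) to the binomial coefficient `c` choose `p`, and
every other word to `0`, is a quasi-shuffle character. For natural `c` it arises from the counit by
`c` steps whose weight is `1` at the letter `0` and `0` at the others; the general case
follows because both sides are polynomial in `c`. -/
theorem isStuffleChar_onZeros [Algebra ℚ R] (c : R) :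
    IsStuffleChar (onZeros (newton fun _ => c)) := by
  have hnat : ∀ n : ℕ, IsStuffleChar (onZeros (newton fun _ => (n : ℚ))) := by
    intro n
    induction n with
    | zero =>
      have : onZeros (newton fun _ => ((0 : ℕ) : ℚ)) = fun w => if w = [] then 1 else 0 := by
        funext w
        cases w <;> simp [onZeros, newton_zero_const]
      rw [this]
      have hz : ∀ a b : List ℕ, stuffleEval (fun _ => (0 : ℚ)) a b = 0 := fun a b => by
        simpa using stuffleEval_mul (0 : ℚ) a b (fun _ => 0)
      refine ⟨by simp, fun a b => ?_⟩
      match a, b with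
      | [], b => simp [stuffleEval]
      | a :: w, [] => simp [stuffleEval]
      | a :: w, b :: v => simp [stuffleEval, hz]
    | succ n ih =>
      have : onZeros (newton fun _ => ((n + 1 : ℕ) : ℚ)) =
          step (fun a => if a = 0 then 1 else 0) (onZeros (newton fun _ => (n : ℚ))) := by
        funext w
        cases w with
        | nil => simp [onZeros, step, newton_zero]
        | cons a w =>
          simp only [onZeros, step, List.forall_mem_cons, Nat.cast_add, Nat.cast_one,
            List.length_cons, newton_add_one]
          by_cases ha : a = 0 <;> simp only [ha, true_and, false_and, if_true, if_false] <;>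
            split_ifs <;> simp
      rw [this]
      refine ih.step fun a b => ?_
      by_cases ha : a = 0 <;> by_cases hb : b = 0 <;> simp [ha, hb]
  -- Pass from natural numbers to the universal case of a polynomial variable.
  have hX : IsStuffleChar (onZeros (newton fun _ => (Polynomial.X : Polynomial ℚ))) := by
    refine ⟨by simp [onZeros, newton_zero], fun a b => ?_⟩
    refine Polynomial.eq_of_infinite_eval_eq _ _
      ((Set.infinite_range_of_injective (Nat.cast_injective (R := ℚ))).mono ?_)
    rintro _ ⟨n, rfl⟩
    have := (hnat n).mul a b
    rw [Set.mem_ofPred_eq, ← Polynomial.coe_evalRingHom, map_mul, map_stuffleEval]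
    simp only [map_onZeros, map_newton, Polynomial.coe_evalRingHom, Polynomial.eval_X]
    exact this
  have := hX.map (Polynomial.aeval c : Polynomial ℚ →ₐ[ℚ] R).toRingHom
  simpa [map_onZeros, map_newton] using this

end Words

/-! ### Laurent series over polynomials in `t` -/

section Formal

variable {R S : Type*} [CommRing R] [CommRing S]

/-- The ring homomorphism of Laurent series that applies `f` to the coefficients. -/
def laurentMap (f : R →+* S) : LaurentSeries R →+* LaurentSeries S where
  toFun F := F.map f
  map_one' := HahnSeries.map_one f.toMonoidWithZeroHom
  map_mul' _ _ := HahnSeries.map_mul f.toNonUnitalRingHom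
  map_zero' := HahnSeries.map_zero f.toMonoidWithZeroHom.toZeroHom
  map_add' _ _ := HahnSeries.map_add f.toAddMonoidHom

theorem coeff_laurentMap (f : R →+* S) (F : LaurentSeries R) (n : ℤ) :
    (laurentMap f F).coeff n = f (F.coeff n) := rfl

/-- The multivariate power series with the given coefficients. -/
def mkMv {σ S : Type*} (c : (σ →₀ ℕ) → S) : MvPowerSeries σ S := c

theorem coeff_mkMv {σ S : Type*} [Semiring S] (c : (σ →₀ ℕ) → S) (m : σ →₀ ℕ) :
    MvPowerSeries.coeff m (mkMv c) = c m := rfl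

/-- The endomorphism of `S[[X]]` that sets `x_i = 0` for `i > N`. -/
def truncVars (S : Type*) [CommRing S] (N : ℕ) : MvPowerSeries ℕ+ S →+* MvPowerSeries ℕ+ S where
  toFun f := mkMv fun m => if ∀ i ∈ m.support, (i : ℕ) ≤ N then MvPowerSeries.coeff m f else 0
  map_one' := by
    classical
    ext m
    rw [coeff_mkMv, MvPowerSeries.coeff_one]
    by_cases hm : m = 0 <;> simp [hm]
  map_mul' f g := by
    classical
    ext m
    rw [coeff_mkMv, MvPowerSeries.coeff_mul, MvPowerSeries.coeff_mul]
    simp only [coeff_mkMv]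
    split_ifs with h
    · refine Finset.sum_congr rfl fun ij hij => ?_
      rw [Finset.HasAntidiagonal.mem_antidiagonal] at hij
      subst hij
      rw [if_pos, if_pos] <;> intro i hi <;> apply h <;>
        simp only [Finsupp.mem_support_iff, Finsupp.add_apply] at hi ⊢ <;> omega
    · symm
      refine Finset.sum_eq_zero fun ij hij => ?_
      rw [Finset.HasAntidiagonal.mem_antidiagonal] at hij
      subst hij
      rw [ite_zero_mul_ite_zero, if_neg]
      rintro ⟨h1, h2⟩
      refine h fun i hi => ?_
      by_cases hi1 : i ∈ ij.1.support
      · exact h1 i hi1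
      · refine h2 i ?_
        simp only [Finsupp.mem_support_iff, Finsupp.add_apply] at hi hi1 ⊢
        omega
  map_zero' := by
    ext m
    simp [coeff_mkMv]
  map_add' f g := by
    ext m
    rw [map_add, coeff_mkMv, coeff_mkMv, coeff_mkMv]
    split_ifs <;> simp

theorem coeff_truncVars (N : ℕ) (f : MvPowerSeries ℕ+ S) (m : ℕ+ →₀ ℕ) :
    MvPowerSeries.coeff m (truncVars S N f) =
      if ∀ i ∈ m.support, (i : ℕ) ≤ N then MvPowerSeries.coeff m f else 0 := rfl

/-- The largest index of a variable occurring in the monomial `x^m` (`0` if there is none). -/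
def varBound (m : ℕ+ →₀ ℕ) : ℕ := m.support.sup fun i => (i : ℕ)

theorem varBound_le_iff {m : ℕ+ →₀ ℕ} {N : ℕ} :
    varBound m ≤ N ↔ ∀ i ∈ m.support, (i : ℕ) ≤ N := by
  simp [varBound]

theorem coeff_truncVars_of_le {N : ℕ} {m : ℕ+ →₀ ℕ} (h : varBound m ≤ N)
    (f : MvPowerSeries ℕ+ S) :
    MvPowerSeries.coeff m (truncVars S N f) = MvPowerSeries.coeff m f := by
  rw [coeff_truncVars, if_pos (varBound_le_iff.1 h)]

/-- A power series is determined by its truncations to finitely many variables. -/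
theorem eq_of_truncVars {f g : MvPowerSeries ℕ+ S}
    (h : ∀ N, truncVars S N f = truncVars S N g) : f = g := by
  ext m
  rw [← coeff_truncVars_of_le le_rfl f, h, coeff_truncVars_of_le le_rfl]

theorem polyT_ext {f g : PolyT S}
    (h : ∀ N, Polynomial.mapRingHom (truncVars S N) f = Polynomial.mapRingHom (truncVars S N) g) :
    f = g := by
  ext1 s
  refine eq_of_truncVars fun N => ?_
  simpa using congrArg (fun p => Polynomial.coeff p s) (h N)

/-- The truncation `x_i = 0` for `i > N`, on `S[[X]][t][z⁻¹, z]]`. -/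
abbrev truncLaurent (S : Type*) [CommRing S] (N : ℕ) : LaurentT S →+* LaurentT S :=
  laurentMap (Polynomial.mapRingHom (truncVars S N))

/-- The coefficient of `zⁿ` has degree at most `n + p` in `t` (so it vanishes for `n < -p`). -/
def DegBound (p : ℤ) (f : LaurentSeries (Polynomial S)) : Prop :=
  ∀ (n : ℤ) (s : ℕ), n + p < s → (f.coeff n).coeff s = 0

theorem DegBound.mul {p p' : ℤ} {f g : LaurentSeries (Polynomial S)} (hf : DegBound p f)
    (hg : DegBound p' g) : DegBound (p + p') (f * g) := by
  intro n s hs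
  rw [HahnSeries.coeff_mul, Polynomial.finsetSum_coeff]
  refine Finset.sum_eq_zero fun ij hij => ?_
  rw [Finset.mem_antidiagonal] at hij
  rw [Polynomial.coeff_mul]
  refine Finset.sum_eq_zero fun ab hab => ?_
  rw [Finset.HasAntidiagonal.mem_antidiagonal] at hab
  by_cases h : ij.1 + p < ab.1
  · rw [hf _ _ h, zero_mul]
  · rw [hg _ _ (by omega), mul_zero]

theorem DegBound.mono {p p' : ℤ} {f : LaurentSeries (Polynomial S)} (hf : DegBound p f)
    (h : p ≤ p') : DegBound p' f := fun n s hs => hf n s (by omega)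

theorem DegBound.add {p : ℤ} {f g : LaurentSeries (Polynomial S)} (hf : DegBound p f)
    (hg : DegBound p g) : DegBound p (f + g) := fun n s hs => by
  simp [hf n s hs, hg n s hs]

theorem DegBound.sub {p : ℤ} {f g : LaurentSeries (Polynomial S)} (hf : DegBound p f)
    (hg : DegBound p g) : DegBound p (f - g) := fun n s hs => by
  simp [hf n s hs, hg n s hs]

theorem degBound_zero (p : ℤ) : DegBound p (0 : LaurentSeries (Polynomial S)) :=
  fun n s _ => by simp

theorem degBound_single (n : ℤ) (a : S) :
    DegBound (-n) (HahnSeries.single n (Polynomial.C a)) := by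
  intro n' s hs
  by_cases h : n' = n
  · subst h
    rw [HahnSeries.coeff_single_same, Polynomial.coeff_C, if_neg (by omega)]
  · rw [HahnSeries.coeff_single_of_ne h, Polynomial.coeff_zero]

theorem degBound_one : DegBound 0 (1 : LaurentSeries (Polynomial S)) := by
  simpa using! degBound_single (0 : ℤ) (1 : S)

theorem DegBound.sum {ι : Type*} {p : ℤ} {s : Finset ι} {f : ι → LaurentSeries (Polynomial S)}
    (h : ∀ i ∈ s, DegBound p (f i)) : DegBound p (∑ i ∈ s, f i) := by
  classical
  induction s using Finset.induction_on with
  | empty => simpa using degBound_zero p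
  | insert i s hi ih =>
    rw [Finset.sum_insert hi]
    exact (h i (by simp)).add (ih fun j hj => h j (by simp [hj]))

theorem degBound_ofPowerSeries {p : ℤ} {f : PowerSeries (Polynomial S)}
    (h : ∀ n : ℕ, ((PowerSeries.coeff n f).natDegree : ℤ) ≤ n + p) :
    DegBound p (HahnSeries.ofPowerSeries ℤ _ f) := by
  intro n s hs
  rw [PowerSeries.coeff_coe]
  split_ifs with hn
  · simp
  · refine Polynomial.coeff_eq_zero_of_natDegree_lt ?_
    have := h n.natAbs
    omega

theorem degBound_newton [Algebra ℚ S] {P : ℕ → LaurentSeries (Polynomial S)}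
    (h : ∀ k, DegBound 1 (P k)) (p : ℕ) : DegBound p (newton P p) := by
  induction p using Nat.strong_induction_on with
  | _ p ih =>
    cases p with
    | zero => simpa [newton_zero] using degBound_one
    | succ p =>
      rw [newton_succ_mul ((HahnSeries.C).comp (Polynomial.C.comp (algebraMap ℚ S)))]
      rw [← zero_add ((p + 1 : ℕ) : ℤ)]
      refine DegBound.mul (degBound_single (0 : ℤ) _) (DegBound.sum fun ij hij => ?_)
      have h1 := Finset.HasAntidiagonal.mem_antidiagonal.1 hij
      rcases neg_one_pow_eq_or (LaurentSeries (Polynomial S)) ij.1 with h2 | h2 <;> rw [h2]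
      · rw [one_mul]
        exact ((h _).mul (ih ij.2 (by omega))).mono (by push_cast; omega)
      · have := ((h (ij.1 + 1)).mul (ih ij.2 (by omega))).mono
          (p' := ((p + 1 : ℕ) : ℤ)) (by push_cast; omega)
        simpa using (degBound_zero _).sub this

theorem degBound_tower {A : Type*} {x : ℕ → A → LaurentSeries (Polynomial S)}
    {f : ℕ → List A → LaurentSeries (Polynomial S)} (hx : ∀ N a, DegBound 0 (x N a))
    (hf : ∀ N w, DegBound w.length (f N w)) (d : ℕ) :
    ∀ N w, DegBound w.length (tower x f d N w) := by
  induction d with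
  | zero => exact hf
  | succ d ih =>
    intro N w
    cases w with
    | nil => exact ih _ _
    | cons a w =>
      rw [tower, step]
      refine (ih _ _).add (((hx N a).mul (ih (N + 1) w)).mono ?_)
      simp

/-- An element of `S[[X]][t][z⁻¹, z]]` may be prescribed monomial by monomial in `X`. The common
bound on poles and degrees guarantees that the coefficients of `zⁿ` assemble into a polynomial in
`t` with coefficients in `S[[X]]`. -/
theorem exists_laurentT_of_degBound (G : (ℕ+ →₀ ℕ) → LaurentT S) {p : ℤ}
    (h : ∀ m, DegBound p (G m)) :
    ∃ F : LaurentT S, ∀ m n s, MvPowerSeries.coeff m ((F.coeff n).coeff s) =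
      MvPowerSeries.coeff m (((G m).coeff n).coeff s) := by
  let c : ℤ → PolyT S := fun n => ∑ s ∈ Finset.range ((n + p).toNat + 1),
    Polynomial.monomial s
      (mkMv fun m => MvPowerSeries.coeff m (((G m).coeff n).coeff s))
  have hc : ∀ m n s, MvPowerSeries.coeff m ((c n).coeff s) =
      MvPowerSeries.coeff m (((G m).coeff n).coeff s) := by
    intro m n s
    simp only [c, Polynomial.finsetSum_coeff, Polynomial.coeff_monomial,
      Finset.sum_ite_eq', Finset.mem_range]
    split_ifs with hs
    · rfl
    · rw [h m n s (by omega)]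
  refine ⟨HahnSeries.ofSuppBddBelow c ⟨-p, ?_⟩, hc⟩
  intro n hn
  by_contra hlt
  refine hn ?_
  ext s m
  rw [hc, h m n s (by omega)]
  simp

end Formal

/-- The sign `(-1) ^ i` acts in the same way on all commutative rings of a given universe. -/
theorem neg_one_pow_mul_eq_or (i : ℕ) :
    (∀ (R : Type) [CommRing R] (x : R), (-1) ^ i * x = x) ∨
      ∀ (R : Type) [CommRing R] (x : R), (-1) ^ i * x = -x := by
  rcases Nat.even_or_odd i with h | h
  · exact Or.inl fun R _ x => by rw [h.neg_one_pow, one_mul]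
  · exact Or.inr fun R _ x => by rw [h.neg_one_pow, neg_one_mul]

/-! ### Formal model of the regularization -/

section Model

/-- The expansion of `e^{(N + 1 + t)δz}`. -/
def expSeries (δ : ℕ+) (N : ℕ) : PowerSeries (PolyT ℚ) :=
  PowerSeries.rescale (((δ : ℕ) : PolyT ℚ) * (Polynomial.X + (N : PolyT ℚ) + 1))
    (PowerSeries.exp (PolyT ℚ))

/-- The expansion of `x_{N+1}^a e^{(N + 1 + t)δz}`. -/
def stepSeries (δ : ℕ+) (N a : ℕ) : PowerSeries (PolyT ℚ) :=
  PowerSeries.C (Polynomial.C (MvPowerSeries.X N.succPNat ^ a)) * expSeries δ N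

/-- The holomorphic part of `powerSum δ N k`, obtained from the generating function
`∑ Bₙ(x) uⁿ / n! = u e^{xu} / (e^u - 1)` of the Bernoulli polynomials, at `x = t + N + 1` and
`u = kδz`. -/
def holSeries (δ : ℕ+) (N k : ℕ) : PowerSeries (PolyT ℚ) :=
  PowerSeries.mk fun n => -((((k : ℚ) * (δ : ℕ)) ^ n / (n + 1).factorial) •
    aeval (Polynomial.X + (N : PolyT ℚ) + 1) (Polynomial.bernoulli (n + 1)))

/-- The Laurent polynomial `1 / (kδz)`, for `k ≥ 1`; the junk value `0` at `k = 0` is never used. -/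
def pole (δ : ℕ+) (k : ℕ) : LaurentT ℚ :=
  HahnSeries.single (-1 : ℤ) (algebraMap ℚ (PolyT ℚ) ((k : ℚ) * (δ : ℕ))⁻¹)

/-- The Laurent expansion of the `k`-th power sum
`∑_{j > N} e^{k(j + t)δz} = e^{k(N + 1 + t)δz} / (1 - e^{kδz})`. -/
def powerSum (δ : ℕ+) (N k : ℕ) : LaurentT ℚ :=
  HahnSeries.ofPowerSeries ℤ _ (holSeries δ N k) - pole δ k

/-- The Laurent expansion of the regularized sum over the indices above `N` for the directed weak
composition `(α, (δ, …, δ))`, with the variables `x_i`, `i > N + d`, set to zero. -/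
def formalReg (δ : ℕ+) (d N : ℕ) (α : List ℕ) : LaurentT ℚ :=
  tower (fun N a => HahnSeries.ofPowerSeries ℤ _ (stepSeries δ N a))
    (fun N => onZeros (newton (powerSum δ N))) d N α

/-- The component `φ₋` of the Birkhoff factorization, on words with constant direction `δ`: it is
supported on the words `(0, …, 0)`, and free of `t` and `X`. -/
def counterterm (δ : ℕ+) : List ℕ → LaurentT ℚ := onZeros (newton (pole δ))

theorem natDegree_aeval_bernoulli (N n : ℕ) :
    (aeval (Polynomial.X + (N : PolyT ℚ) + 1) (Polynomial.bernoulli n)).natDegree ≤ n := by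
  rw [Polynomial.bernoulli, map_sum]
  refine Polynomial.natDegree_sum_le_of_forall_le _ _ fun i hi => ?_
  rw [Polynomial.aeval_monomial]
  rw [Finset.mem_range] at hi
  have h1 : (Polynomial.X + (N : PolyT ℚ) + 1).natDegree ≤ 1 := by
    have : (Polynomial.X + (N : PolyT ℚ) + 1) =
        Polynomial.X + Polynomial.C ((N : MvPowerSeries ℕ+ ℚ) + 1) := by
      simp [add_assoc]
    rw [this]
    rw [Polynomial.natDegree_X_add_C]
  rw [← Algebra.smul_def]
  refine (Polynomial.natDegree_smul_le _ _).trans ?_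
  refine (Polynomial.natDegree_pow_le_of_le _ h1).trans ?_
  omega

theorem degBound_formalReg (δ : ℕ+) (d N : ℕ) (α : List ℕ) :
    DegBound α.length (formalReg δ d N α) := by
  have hX : ∀ N : ℕ, (((δ : ℕ) : PolyT ℚ) * (Polynomial.X + (N : PolyT ℚ) + 1)).natDegree ≤ 1 := by
    intro N
    have : (((δ : ℕ) : PolyT ℚ) * (Polynomial.X + (N : PolyT ℚ) + 1)) =
        Polynomial.C ((δ : ℕ) : MvPowerSeries ℕ+ ℚ) * Polynomial.X +
          Polynomial.C ((δ : ℕ) * ((N : MvPowerSeries ℕ+ ℚ) + 1)) := by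
      simp; ring
    rw [this]
    exact Polynomial.natDegree_linear_le
  refine degBound_tower (fun N a => ?_) (fun N w => ?_) d N α
  · refine degBound_ofPowerSeries fun n => ?_
    rw [stepSeries, PowerSeries.coeff_C_mul, expSeries, PowerSeries.coeff_rescale,
      PowerSeries.coeff_exp, mul_comm (_ ^ n), ← Algebra.smul_def]
    have h1 := (Polynomial.natDegree_C_mul_le (MvPowerSeries.X N.succPNat ^ a)
      ((1 / (n.factorial : ℚ)) • (((δ : ℕ) : PolyT ℚ) * (Polynomial.X + (N : PolyT ℚ) + 1)) ^ n))
    have h2 := Polynomial.natDegree_smul_le (1 / (n.factorial : ℚ))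
      ((((δ : ℕ) : PolyT ℚ) * (Polynomial.X + (N : PolyT ℚ) + 1)) ^ n)
    have h3 := Polynomial.natDegree_pow_le_of_le n (hX N)
    omega
  · rw [onZeros]
    split_ifs
    · refine degBound_newton (fun k => ?_) _
      refine DegBound.sub (degBound_ofPowerSeries fun n => ?_) ?_
      · rw [holSeries, PowerSeries.coeff_mk, Polynomial.natDegree_neg]
        have h1 := Polynomial.natDegree_smul_le ((((k : ℚ) * (δ : ℕ)) ^ n / (n + 1).factorial))
          (aeval (Polynomial.X + (N : PolyT ℚ) + 1) (Polynomial.bernoulli (n + 1)))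
        have h2 := natDegree_aeval_bernoulli N (n + 1)
        omega
      · exact degBound_single (-1) ((MvPowerSeries.C (((k : ℚ) * (δ : ℕ))⁻¹) : MvPowerSeries ℕ+ ℚ))
    · exact degBound_zero _

/-- Convolution with the counterterm removes all poles: on the words `(0, …, 0)` it subtracts
`-1 / (kδz)` from the `k`-th power sum, and it commutes with the addition of indices, whose weights
are holomorphic. -/
theorem conv_formalReg_counterterm (δ : ℕ+) (d N : ℕ) :
    conv (formalReg δ d N) (counterterm δ) = fun α => HahnSeries.ofPowerSeries ℤ _
      (tower (stepSeries δ) (fun N => onZeros (newton (holSeries δ N))) d N α) := by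
  have h : ∀ N, conv (onZeros (newton (powerSum δ N))) (counterterm δ) =
      fun α => HahnSeries.ofPowerSeries ℤ _ (onZeros (newton (holSeries δ N)) α) := by
    intro N
    funext α
    rw [counterterm, conv_onZeros, map_onZeros (R := PowerSeries (PolyT ℚ)) (S := LaurentT ℚ)
      (HahnSeries.ofPowerSeries ℤ (PolyT ℚ))]
    congr 1
    funext p
    rw [← newton_add, map_newton (R := PowerSeries (PolyT ℚ)) (S := LaurentT ℚ)
      (HahnSeries.ofPowerSeries ℤ (PolyT ℚ))]
    congr 1
    funext k
    exact sub_add_cancel (G := LaurentT ℚ) _ _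
  funext α
  have := conv_tower (fun N a => HahnSeries.ofPowerSeries ℤ _ (stepSeries δ N a))
    (fun N => onZeros (newton (powerSum δ N))) (counterterm δ) d N
  simp only [h] at this
  rw [map_tower (R := PowerSeries (PolyT ℚ)) (S := LaurentT ℚ)
    (HahnSeries.ofPowerSeries ℤ (PolyT ℚ)), ← this]
  rfl

/-- The value at `z = 0` of the convolution of `formalReg` and `counterterm`: a nested sum of
monomials, starting from the binomial coefficients of `-(t + N + d + 1/2)`. It no longer involves
the direction. -/
def renTower (d N : ℕ) (α : List ℕ) : PolyT ℚ :=
  tower (fun N a => Polynomial.C (MvPowerSeries.X N.succPNat ^ a))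
    (fun N => onZeros (newton fun _ => -(Polynomial.X + (N : PolyT ℚ) + algebraMap ℚ _ 2⁻¹)))
    d N α

theorem constantCoeff_holSeries (δ : ℕ+) (N k : ℕ) :
    PowerSeries.constantCoeff (holSeries δ N k) =
      -(Polynomial.X + (N : PolyT ℚ) + algebraMap ℚ _ 2⁻¹) := by
  rw [← PowerSeries.coeff_zero_eq_constantCoeff_apply, holSeries, PowerSeries.coeff_mk]
  simp only [zero_add, Polynomial.bernoulli_one, map_sub, Polynomial.aeval_X, Polynomial.aeval_C,
    pow_zero, Nat.factorial_one, Nat.cast_one, div_one, one_smul]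
  have : (1 : PolyT ℚ) = algebraMap ℚ _ 2⁻¹ + algebraMap ℚ _ 2⁻¹ := by
    rw [← map_add]; norm_num
  linear_combination -this

theorem coeff_zero_conv_formalReg (δ : ℕ+) (d N : ℕ) (α : List ℕ) :
    (conv (formalReg δ d N) (counterterm δ) α).coeff 0 = renTower d N α := by
  rw [conv_formalReg_counterterm, PowerSeries.coeff_coe, if_neg (by simp)]
  change PowerSeries.coeff 0 _ = _
  rw [PowerSeries.coeff_zero_eq_constantCoeff_apply, map_tower, renTower]
  congr 1
  · funext N a
    rw [stepSeries, map_mul, PowerSeries.constantCoeff_C, expSeries,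
      ← PowerSeries.coeff_zero_eq_constantCoeff_apply, PowerSeries.coeff_rescale]
    simp
  · funext N w
    rw [map_onZeros]
    congr 1
    funext p
    rw [map_newton]
    congr 1
    funext k
    exact constantCoeff_holSeries δ N k

theorem coeff_conv_formalReg_of_neg (δ : ℕ+) (d N : ℕ) (α : List ℕ) {n : ℤ} (hn : n < 0) :
    (conv (formalReg δ d N) (counterterm δ) α).coeff n = 0 := by
  rw [conv_formalReg_counterterm, PowerSeries.coeff_coe, if_pos hn]

theorem isStuffleChar_renTower (d N : ℕ) : IsStuffleChar (renTower d N) :=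
  IsStuffleChar.tower (fun N a b => by rw [pow_add, map_mul]) d N (isStuffleChar_onZeros _)

/-- The counterterm of a nonempty word is purely polar. -/
theorem coeff_counterterm_of_nonneg (δ : ℕ+) {α : List ℕ} (hα : α ≠ []) {n : ℤ} (hn : 0 ≤ n) :
    (counterterm δ α).coeff n = 0 := by
  -- The word of length `0` contributes a constant term, so the induction needs the bound `n ≤ 0`
  -- there and `n < 0` for positive length.
  have key : ∀ p : ℕ, ∀ n : ℤ, 0 < n ∨ (p ≠ 0 ∧ n = 0) → (newton (pole δ) p).coeff n = 0 := by
    intro p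
    induction p using Nat.strong_induction_on with
    | _ p ih =>
      cases p with
      | zero =>
        intro n hn
        rw [newton_zero, HahnSeries.coeff_one, if_neg (by omega)]
      | succ p =>
        intro n hn
        rw [newton_succ_mul ((HahnSeries.C).comp (algebraMap ℚ (PolyT ℚ))), RingHom.comp_apply,
          HahnSeries.C_apply, HahnSeries.coeff_single_mul, HahnSeries.coeff_sum,
          Finset.sum_eq_zero, mul_zero]
        intro ij hij
        have h1 := Finset.HasAntidiagonal.mem_antidiagonal.1 hij
        have h3 : (pole δ (ij.1 + 1) * newton (pole δ) ij.2).coeff (n - 0) = 0 := by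
          rw [pole, HahnSeries.coeff_single_mul, ih ij.2 (by omega) _ (by omega), mul_zero]
        rw [mul_assoc]
        rcases neg_one_pow_mul_eq_or ij.1 with h2 | h2
        · rw [h2, h3]
        · rw [h2, HahnSeries.coeff_neg, h3, neg_zero]
  rw [counterterm, onZeros]
  split_ifs
  · refine key _ _ ?_
    have := List.length_pos_iff.2 hα
    omega
  · rfl

end Model

/-! ### Convergent Laurent series -/

section Scalar

/-- The Laurent series `G` converges at `z`, with sum `a`. -/
def ConvergesTo (z : ℂ) (G : LaurentSeries ℂ) (a : ℂ) : Prop :=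
  HasSum (fun n : ℤ => G.coeff n * z ^ n) a

theorem hasSum_mul_prod {F G : ℤ → ℂ} {a b : ℂ} (hF : HasSum F a) (hG : HasSum G b) :
    HasSum (fun ij : ℤ × ℤ => F ij.1 * G ij.2) (a * b) := by
  have h1 : Summable fun n : ℤ => ‖F n‖ := hF.summable.norm
  have h2 : Summable fun n : ℤ => ‖G n‖ := hG.summable.norm
  have h3 := summable_mul_of_summable_norm h1 h2
  exact hF.mul hG h3

theorem hasSum_laurent_mul {f g : ℤ → ℂ} {z a b : ℂ} (hz : z ≠ 0)
    (hf : HasSum (fun n : ℤ => f n * z ^ n) a) (hg : HasSum (fun n : ℤ => g n * z ^ n) b)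
    {s : ℤ → Finset (ℤ × ℤ)} (hs : ∀ n, ∀ ij ∈ s n, ij.1 + ij.2 = n)
    (hs' : ∀ i j, (i, j) ∉ s (i + j) → f i * g j = 0) :
    HasSum (fun n : ℤ => (∑ ij ∈ s n, f ij.1 * g ij.2) * z ^ n) (a * b) := by
  have h := hasSum_mul_prod hf hg
  let e : ℤ × ℤ ≃ ℤ × ℤ :=
    { toFun := fun p => (p.2, p.1 - p.2)
      invFun := fun p => (p.1 + p.2, p.1)
      left_inv := fun p => by simp
      right_inv := fun p => by simp }
  refine ((e.hasSum_iff).2 h).prod_fiberwise fun n => ?_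
  have h2 : (∑ ij ∈ s n, f ij.1 * g ij.2) * z ^ n =
      ∑ i ∈ (s n).image Prod.fst, (f i * z ^ i) * (g (n - i) * z ^ (n - i)) := by
    rw [Finset.sum_image, Finset.sum_mul]
    · refine Finset.sum_congr rfl fun ij hij => ?_
      have := hs n ij hij
      rw [show n - ij.1 = ij.2 by omega, show n = ij.1 + ij.2 from this.symm, zpow_add₀ hz]
      ring
    · intro x hx y hy hxy
      have h1 := hs n x hx
      have h3 := hs n y hy
      exact Prod.ext hxy (by omega)
  rw [h2]
  refine hasSum_sum_of_ne_finset_zero fun i hi => ?_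
  have : (i, n - i) ∉ s (i + (n - i)) := by
    rw [show i + (n - i) = n by omega]
    exact fun h => hi (Finset.mem_image_of_mem _ h)
  change (f i * z ^ i) * (g (n - i) * z ^ (n - i)) = 0
  linear_combination (z ^ i * z ^ (n - i)) * hs' _ _ this

theorem ConvergesTo.mul {z a b : ℂ} {F G : LaurentSeries ℂ} (hz : z ≠ 0)
    (hF : ConvergesTo z F a) (hG : ConvergesTo z G b) : ConvergesTo z (F * G) (a * b) := by
  refine hasSum_laurent_mul (s := fun n => Finset.antidiagonal F.isPWO_support G.isPWO_support n)
    hz hF hG (fun n ij hij => ?_) (fun i j hij => ?_)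
  · exact (Finset.mem_antidiagonal.1 hij).2.2
  · by_contra h
    exact hij (Finset.mem_antidiagonal.2 ⟨left_ne_zero_of_mul h, right_ne_zero_of_mul h, rfl⟩)

theorem hasSum_int_of_nat {f : ℤ → ℂ} {a : ℂ} (h0 : ∀ n < 0, f n = 0)
    (h : HasSum (fun n : ℕ => f n) a) : HasSum f a := by
  refine (Nat.cast_injective.hasSum_iff (fun n hn => h0 n ?_)).1 h
  by_contra hlt
  exact hn ⟨n.toNat, by simpa using hlt⟩

theorem convergesTo_ofPowerSeries {z a : ℂ} {f : PowerSeries ℂ}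
    (h : HasSum (fun n : ℕ => PowerSeries.coeff n f * z ^ n) a) :
    ConvergesTo z (HahnSeries.ofPowerSeries ℤ ℂ f) a := by
  refine hasSum_int_of_nat (fun n hn => ?_) ?_
  · rw [PowerSeries.coeff_coe, if_pos hn, zero_mul]
  · refine h.congr_fun fun n => ?_
    rw [PowerSeries.coeff_coe, if_neg (by omega), Int.natAbs_natCast, zpow_natCast]

/-- Uniqueness of Laurent expansions, along any filter of points tending to `0`. -/
theorem eq_zero_of_convergesTo_zero {l : Filter ℂ} [l.NeBot] (hl : l ≤ 𝓝[≠] 0)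
    {G : LaurentSeries ℂ} (h : ∀ᶠ z in l, ConvergesTo z G 0) : G = 0 := by
  by_contra hG
  set d := G.order with hd
  have h1 : ∀ᶠ z in l, HasSum (fun k : ℕ => G.coeff (d + k) * z ^ k) 0 := by
    filter_upwards [h, hl self_mem_nhdsWithin] with z hz hz0
    have hz0 : z ≠ 0 := hz0
    have h2 : HasSum (fun n : ℤ => z ^ (-d) * (G.coeff n * z ^ n)) 0 := by
      simpa using! HasSum.mul_left (z ^ (-d)) hz
    have hinj : Function.Injective (fun k : ℕ => d + (k : ℤ)) := fun a b hab => by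
      simpa using hab
    refine ((hinj.hasSum_iff (fun n hn => ?_)).2 h2).congr_fun ?_
    · rw [HahnSeries.coeff_eq_zero_of_lt_order, zero_mul, mul_zero]
      by_contra hlt
      exact hn ⟨(n - d).toNat, by simp; omega⟩
    · intro k
      simp only [Function.comp_apply, zpow_add₀ hz0, zpow_natCast, zpow_neg]
      field_simp
  -- The sum at one point `z0` of the filter dominates the sums at all smaller points, so the
  -- shifted series tends to its constant term.
  obtain ⟨z0, hz0, hz0'⟩ := (h1.and (hl self_mem_nhdsWithin)).exists
  have hz0' : z0 ≠ 0 := hz0'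
  have hT : Tendsto (fun z : ℂ => ∑' k : ℕ, G.coeff (d + k) * z ^ k) l
      (𝓝 (∑' k : ℕ, G.coeff (d + k) * (0 : ℂ) ^ k)) := by
    refine tendsto_tsum_of_dominated_convergence hz0.summable.norm (fun k => ?_) ?_
    · have : Tendsto (fun z : ℂ => z) l (𝓝 0) := hl.trans nhdsWithin_le_nhds
      exact (this.pow k).const_mul _
    · have : ∀ᶠ z : ℂ in l, ‖z‖ < ‖z0‖ := by
        refine (hl.trans nhdsWithin_le_nhds) ?_
        filter_upwards [Metric.ball_mem_nhds (0 : ℂ) (norm_pos_iff.2 hz0')] with z hz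
        simpa using hz
      filter_upwards [this] with z hz k
      rw [norm_mul, norm_mul, norm_pow, norm_pow]
      gcongr
  have hT0 : Tendsto (fun z : ℂ => ∑' k : ℕ, G.coeff (d + k) * z ^ k) l (𝓝 0) := by
    refine tendsto_const_nhds.congr' ?_
    filter_upwards [h1] with z hz
    exact hz.tsum_eq.symm
  have h3 := tendsto_nhds_unique hT hT0
  rw [tsum_eq_single 0 (fun k hk => by rw [zero_pow hk, mul_zero])] at h3
  have h4 : G.coeff G.order ≠ 0 := by
    rwa [Ne, HahnSeries.coeff_order_eq_zero]
  exact h4 (by simpa [hd] using! h3)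

theorem eq_of_convergesTo {l : Filter ℂ} [l.NeBot] (hl : l ≤ 𝓝[≠] 0)
    {G H : LaurentSeries ℂ} {g : ℂ → ℂ} (hG : ∀ᶠ z in l, ConvergesTo z G (g z))
    (hH : ∀ᶠ z in l, ConvergesTo z H (g z)) : G = H := by
  refine sub_eq_zero.1 (eq_zero_of_convergesTo_zero hl ?_)
  filter_upwards [hG, hH] with z h1 h2
  have := HasSum.sub h1 h2
  rw [sub_self] at this
  refine this.congr_fun fun n => ?_
  simp [sub_mul]

theorem hasSum_exp (w : ℂ) :
    HasSum (fun n : ℕ => ((n.factorial : ℂ))⁻¹ * w ^ n) (Complex.exp w) := by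
  have := NormedSpace.expSeries_div_hasSum_exp (𝔸 := ℂ) w
  rw [← Complex.exp_eq_exp_ℂ] at this
  exact this.congr_fun fun n => by rw [div_eq_inv_mul]

/-- The generating function of the Bernoulli polynomials as a convergent series. The right-hand
side extends to an analytic function at `0`; its Taylor coefficients satisfy the same
identity of formal power series as the Bernoulli polynomials. -/
theorem hasSum_bernoulli_near_zero (x : ℂ) : ∀ᶠ u : ℂ in 𝓝[≠] 0,
    HasSum (fun n : ℕ => aeval x ((1 / n.factorial : ℚ) • Polynomial.bernoulli n) * u ^ n)
      (u * Complex.exp (x * u) / (Complex.exp u - 1)) := by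
  have hexp : AnalyticAt ℂ Complex.exp 0 := by fun_prop
  obtain ⟨p0, hp0⟩ := hexp
  have hg : AnalyticAt ℂ (dslope Complex.exp 0) 0 := ⟨_, hp0.has_fpower_series_dslope_fslope⟩
  have hg0 : dslope Complex.exp 0 0 ≠ 0 := by
    rw [dslope_same, Complex.deriv_exp, Complex.exp_zero]
    exact one_ne_zero
  have hf : AnalyticAt ℂ (fun u => Complex.exp (x * u) / dslope Complex.exp 0 u) 0 :=
    AnalyticAt.div (by fun_prop) hg hg0
  obtain ⟨p, hp⟩ := hf
  have hne : ∀ᶠ u : ℂ in 𝓝[≠] 0, Complex.exp u - 1 ≠ 0 := by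
    have h1 : ∀ᶠ u : ℂ in 𝓝[≠] 0, dslope Complex.exp 0 u ≠ 0 :=
      (hg.continuousAt.eventually_ne hg0).filter_mono nhdsWithin_le_nhds
    filter_upwards [h1, self_mem_nhdsWithin] with u hu hu0 h
    refine hu ?_
    rw [dslope_of_ne _ hu0, slope_def_field, Complex.exp_zero, h, zero_div]
  have hval : ∀ᶠ u : ℂ in 𝓝[≠] 0, HasSum (fun n : ℕ => p.coeff n * u ^ n)
      (u * Complex.exp (x * u) / (Complex.exp u - 1)) := by
    filter_upwards [hp.eventually_hasSum.filter_mono nhdsWithin_le_nhds, self_mem_nhdsWithin, hne]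
      with u hu hu0 hue
    have hu0 : u ≠ 0 := hu0
    have h1 : Complex.exp (x * u) / dslope Complex.exp 0 u =
        u * Complex.exp (x * u) / (Complex.exp u - 1) := by
      rw [dslope_of_ne _ hu0, slope_def_field, Complex.exp_zero, sub_zero]
      field_simp
    rw [zero_add, h1] at hu
    refine hu.congr_fun fun n => ?_
    rw [FormalMultilinearSeries.apply_eq_pow_smul_coeff, smul_eq_mul, mul_comm]
  set c : PowerSeries ℂ := PowerSeries.mk p.coeff with hc
  have hid : c * (PowerSeries.exp ℂ - 1) =
      PowerSeries.X * PowerSeries.rescale x (PowerSeries.exp ℂ) := by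
    apply HahnSeries.ofPowerSeries_injective (Γ := ℤ)
    refine eq_of_convergesTo le_rfl (g := fun u => u * Complex.exp (x * u)) ?_ ?_
    · filter_upwards [hval, self_mem_nhdsWithin, hne] with u hu hu0 hue
      have h1 : ConvergesTo u (HahnSeries.ofPowerSeries ℤ ℂ c) _ :=
        convergesTo_ofPowerSeries (by simpa [hc] using hu)
      have h2 : ConvergesTo u (HahnSeries.ofPowerSeries ℤ ℂ (PowerSeries.exp ℂ - 1))
          (Complex.exp u - 1) := by
        refine convergesTo_ofPowerSeries ?_
        have h3 : HasSum (fun n : ℕ => PowerSeries.coeff n (1 : PowerSeries ℂ) * u ^ n) 1 := by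
          have := hasSum_ite_eq (0 : ℕ) (1 : ℂ)
          refine this.congr_fun fun n => ?_
          rw [PowerSeries.coeff_one]
          by_cases hn : n = 0 <;> simp [hn]
        refine ((hasSum_exp u).sub h3).congr_fun fun n => ?_
        simp [PowerSeries.coeff_exp, sub_mul]
      have h4 := h1.mul hu0 h2
      rw [div_mul_cancel₀ _ hue] at h4
      rwa [map_mul]
    · filter_upwards [self_mem_nhdsWithin] with u hu0
      rw [map_mul, HahnSeries.ofPowerSeries_X]
      refine ConvergesTo.mul hu0 ?_ ?_
      · refine (hasSum_ite_eq (1 : ℤ) u).congr_fun fun n => ?_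
        rw [HahnSeries.coeff_single]
        by_cases hn : n = 1 <;> simp [hn]
      · refine convergesTo_ofPowerSeries ((hasSum_exp (x * u)).congr_fun fun n => ?_)
        simp [PowerSeries.coeff_rescale, PowerSeries.coeff_exp]
        ring
  have hb := Polynomial.bernoulli_generating_function x
  have hc2 : c = PowerSeries.mk fun n =>
      aeval x ((1 / n.factorial : ℚ) • Polynomial.bernoulli n) := by
    have hne0 : PowerSeries.exp ℂ - 1 ≠ 0 := by
      intro h
      have := congrArg (PowerSeries.coeff 1) h
      simp [PowerSeries.coeff_exp, PowerSeries.coeff_one] at this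
    exact mul_right_cancel₀ hne0 (hid.trans hb.symm)
  filter_upwards [hval] with u hu
  refine hu.congr_fun fun n => ?_
  have := congrArg (PowerSeries.coeff n) hc2
  rw [hc, PowerSeries.coeff_mk, PowerSeries.coeff_mk] at this
  rw [this]

end Scalar

/-! ### Nested sums -/

section Sums

/-- The index `i + N`. -/
def shiftIdx (N : ℕ) (i : ℕ+) : ℕ+ := ⟨i + N, by positivity⟩

/-- The successor, as an order embedding of the positive integers. -/
def pnatSucc : ℕ+ ↪o ℕ+ := OrderEmbedding.ofStrictMono (fun i => i + 1) fun _ _ h => by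
  simpa using h

/-- The index sequence `1 < j₁ + 1 < ⋯ < jₙ + 1`. -/
def consOne {n : ℕ} (j : Fin n ↪o ℕ+) : Fin (n + 1) ↪o ℕ+ :=
  OrderEmbedding.ofStrictMono (Fin.cons 1 fun l => j l + 1) <| by
    refine Fin.strictMono_iff_lt_succ.2 fun l => ?_
    cases n with
    | zero => exact l.elim0
    | succ n =>
      refine Fin.cases ?_ (fun l => ?_) l
      · simp
      · rw [← Fin.succ_castSucc, Fin.cons_succ, Fin.cons_succ]
        simp

theorem consOne_zero {n : ℕ} (j : Fin n ↪o ℕ+) : consOne j 0 = 1 := rfl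

theorem consOne_succ {n : ℕ} (j : Fin n ↪o ℕ+) (l : Fin n) : consOne j l.succ = j l + 1 := rfl

theorem exists_shift {n : ℕ} (i : Fin n ↪o ℕ+) (h : ∀ l, i l ≠ 1) :
    ∃ j : Fin n ↪o ℕ+, ∀ l, i l = j l + 1 := by
  choose k hk using fun l => PNat.exists_eq_succ_of_ne_one (h l)
  refine ⟨OrderEmbedding.ofStrictMono k fun a b hab => ?_, hk⟩
  have := i.strictMono hab
  rw [hk, hk] at this
  simpa using this

/-- An index sequence `i₁ < ⋯ < i_{n+1}` either starts with `1`, or consists of indices at least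
`2`. -/
def splitFirst (n : ℕ) :
    (Fin n ↪o ℕ+) ⊕ (Fin (n + 1) ↪o ℕ+) ≃ (Fin (n + 1) ↪o ℕ+) :=
  Equiv.ofBijective (Sum.elim consOne fun i => i.trans pnatSucc) <| by
    constructor
    · rintro (j | i) (j' | i') h
      · congr 1
        ext l
        have := DFunLike.congr_fun h l.succ
        simpa [consOne_succ] using congrArg PNat.val this
      · exact absurd (DFunLike.congr_fun h 0).symm (PNat.lt_add_left 1 (i' 0)).ne'
      · exact absurd (DFunLike.congr_fun h 0) (PNat.lt_add_left 1 (i 0)).ne'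
      · congr 1
        ext l
        have := DFunLike.congr_fun h l
        simpa [pnatSucc] using congrArg PNat.val this
    · intro i
      by_cases h : i 0 = 1
      · obtain ⟨j, hj⟩ := exists_shift ((Fin.succOrderEmb n).trans i) (fun l hl => by
          have h1 := i.strictMono (Fin.succ_pos l)
          rw [h] at h1
          exact h1.ne' hl)
        refine ⟨Sum.inl j, ?_⟩
        refine DFunLike.ext _ _ fun l => ?_
        refine Fin.cases h.symm (fun l => ?_) l
        exact (hj l).symm
      · obtain ⟨j, hj⟩ := exists_shift i (fun l hl => by
          have h1 := i.monotone (Fin.zero_le l)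
          rw [hl] at h1
          exact h (le_antisymm h1 one_le))
        exact ⟨Sum.inr j, DFunLike.ext _ _ fun l => (hj l).symm⟩

theorem splitFirst_inl {n : ℕ} (j : Fin n ↪o ℕ+) : splitFirst n (Sum.inl j) = consOne j := rfl

theorem splitFirst_inr {n : ℕ} (i : Fin (n + 1) ↪o ℕ+) :
    splitFirst n (Sum.inr i) = i.trans pnatSucc := rfl

theorem tsum_splitFirst {n : ℕ} {f : (Fin (n + 1) ↪o ℕ+) → ℂ} (hf : Summable f) :
    ∑' i, f i = ∑' i : Fin (n + 1) ↪o ℕ+, f (i.trans pnatSucc) + ∑' j, f (consOne j) := by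
  have h : Summable fun x => f (splitFirst n x) := (splitFirst n).summable_iff.2 hf
  refine Eq.trans ?_ (add_comm _ _)
  rw [← (splitFirst n).tsum_eq,
    Summable.tsum_sum (h.comp_injective Sum.inl_injective) (h.comp_injective Sum.inr_injective)]
  simp only [splitFirst_inl, splitFirst_inr]

/-- The summand of the regularized sum at the index sequence `i₁ + N < ⋯ < iₙ + N`. -/
def shiftTerm (w : List (ℕ × ℕ+)) (N : ℕ) (t : ℝ) (z : ℂ) (i : Fin w.length ↪o ℕ+) :
    MvPowerSeries ℕ+ ℂ :=
  MvPowerSeries.monomial (∑ l, Finsupp.single (shiftIdx N (i l)) (w.get l).1)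
    (∏ l, Complex.exp (((shiftIdx N (i l) : ℕ) + (t : ℂ)) * (((w.get l).2 : ℕ) : ℂ) * z))

theorem norm_coeff_shiftTerm_le (w : List (ℕ × ℕ+)) (N : ℕ) {t : ℝ} (ht : 0 ≤ t) {z : ℂ}
    (hz : z.re < 0) (m : ℕ+ →₀ ℕ) (i : Fin w.length ↪o ℕ+) :
    ‖MvPowerSeries.coeff m (shiftTerm w N t z i)‖ ≤ ∏ l, Real.exp z.re ^ (i l : ℕ) := by
  classical
  rw [shiftTerm, MvPowerSeries.coeff_monomial]
  split_ifs
  · rw [norm_prod]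
    refine Finset.prod_le_prod (fun _ _ => norm_nonneg _) fun l _ => ?_
    rw [Complex.norm_exp, ← Real.exp_nat_mul, Real.exp_le_exp]
    have h1 : ((((shiftIdx N (i l) : ℕ) + (t : ℂ)) * (((w.get l).2 : ℕ) : ℂ) * z)).re =
        (((shiftIdx N (i l) : ℕ) + t) * (((w.get l).2 : ℕ) : ℝ)) * z.re := by
      simp
    rw [h1]
    refine mul_le_mul_of_nonpos_right ?_ hz.le
    have h2 : (1 : ℝ) ≤ ((w.get l).2 : ℕ) := by exact_mod_cast (w.get l).2.pos
    have h3 : ((shiftIdx N (i l) : ℕ) : ℝ) = (i l : ℕ) + N := by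
      simp [shiftIdx]
    rw [h3]
    have h4 : (0 : ℝ) ≤ (i l : ℕ) := by positivity
    have h5 : (0 : ℝ) ≤ N := by positivity
    nlinarith
  · rw [norm_zero]
    positivity

theorem summable_coeff_shiftTerm (w : List (ℕ × ℕ+)) (N : ℕ) {t : ℝ} (ht : 0 ≤ t) {z : ℂ}
    (hz : z.re < 0) (m : ℕ+ →₀ ℕ) :
    Summable fun i => MvPowerSeries.coeff m (shiftTerm w N t z i) := by
  refine Summable.of_norm_bounded ?_ (norm_coeff_shiftTerm_le w N ht hz m)
  have h1 : Summable fun i : ℕ+ => Real.exp z.re ^ (i : ℕ) :=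
    (summable_geometric_of_lt_one (Real.exp_pos _).le (by simpa using hz)).comp_injective
      PNat.coe_injective
  have h2 := summable_finsetProd_of_summable_nonneg (fun i : ℕ+ => by positivity) h1
  have hinj : Function.Injective
      fun i : Fin w.length ↪o ℕ+ => Finset.univ.map i.toEmbedding := by
    intro i j hij
    rw [← OrderEmbedding.range_inj]
    have := congrArg (fun s : Finset ℕ+ => (s : Set ℕ+)) hij
    simpa using this
  refine (h2.comp_injective hinj).congr fun i => ?_
  simp

/-- The regularized sum over the index sequences `N < i₁ < ⋯ < iₙ`, at a point `(t, z)`,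
summed coefficientwise in the monomials in `X`. -/
def shiftSum (w : List (ℕ × ℕ+)) (N : ℕ) (t : ℝ) (z : ℂ) : MvPowerSeries ℕ+ ℂ :=
  mkMv fun m => ∑' i, MvPowerSeries.coeff m (shiftTerm w N t z i)

/-- The value `x_{N+1}^a e^{(N + 1 + t)δz}` of `stepSeries` at `(t, z)`. -/
def stepValue (δ : ℕ+) (t : ℝ) (z : ℂ) (N a : ℕ) : MvPowerSeries ℕ+ ℂ :=
  MvPowerSeries.X N.succPNat ^ a * MvPowerSeries.C (Complex.exp ((δ : ℕ) * (t + N + 1) * z))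

theorem shiftSum_nil (N : ℕ) (t : ℝ) (z : ℂ) : shiftSum [] N t z = 1 := by
  classical
  ext m
  have : ∀ i : Fin ([] : List (ℕ × ℕ+)).length ↪o ℕ+, shiftTerm [] N t z i = 1 := by
    intro i
    simp [shiftTerm]
  let _ : Unique (Fin ([] : List (ℕ × ℕ+)).length ↪o ℕ+) :=
    { default := OrderEmbedding.ofStrictMono (fun l => l.elim0) fun l => l.elim0
      uniq := fun i => DFunLike.ext _ _ fun l => l.elim0 }
  rw [shiftSum, coeff_mkMv]
  rw [tsum_congr fun i => by rw [this i], tsum_fintype]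
  simp

/-- The sum over the indices above `N` arises from the one over the indices above `N + 1` by a
`step`. -/
theorem shiftSum_cons (a : ℕ) (δ : ℕ+) (w : List (ℕ × ℕ+)) (N : ℕ) {t : ℝ} (ht : 0 ≤ t) {z : ℂ}
    (hz : z.re < 0) :
    shiftSum ((a, δ) :: w) N t z =
      shiftSum ((a, δ) :: w) (N + 1) t z + stepValue δ t z N a * shiftSum w (N + 1) t z := by
  classical
  have hidx : ∀ i : ℕ+, shiftIdx N (i + 1) = shiftIdx (N + 1) i := by
    intro i
    apply PNat.eq
    simp [shiftIdx]
    omega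
  have hidx1 : shiftIdx N 1 = N.succPNat := by
    apply PNat.eq
    simp [shiftIdx]
    omega
  have h1 : ∀ i : Fin (w.length + 1) ↪o ℕ+, shiftTerm ((a, δ) :: w) N t z (i.trans pnatSucc) =
      shiftTerm ((a, δ) :: w) (N + 1) t z i := by
    intro i
    simp only [shiftTerm]
    congr 1
    · congr 1
      refine Finset.sum_congr rfl fun l _ => ?_
      rw [← hidx]
      rfl
    · refine Finset.prod_congr rfl fun l _ => ?_
      rw [← hidx]
      rfl
  have h2 : ∀ j : Fin w.length ↪o ℕ+, shiftTerm ((a, δ) :: w) N t z (consOne j) =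
      stepValue δ t z N a * shiftTerm w (N + 1) t z j := by
    intro j
    have hs : stepValue δ t z N a = MvPowerSeries.monomial (Finsupp.single N.succPNat a)
        (Complex.exp ((N.succPNat + (t : ℂ)) * (δ : ℕ) * z)) := by
      rw [stepValue, MvPowerSeries.X_pow_eq, ← MvPowerSeries.monomial_zero_eq_C_apply,
        MvPowerSeries.monomial_mul_monomial, add_zero, one_mul]
      congr 2
      rw [Nat.succPNat_coe]
      push_cast
      ring
    rw [hs, shiftTerm, shiftTerm, MvPowerSeries.monomial_mul_monomial]
    congr 1
    · congr 1
      refine (Fin.sum_univ_succ _).trans ?_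
      congr 1
      · rw [consOne_zero, hidx1]; rfl
      · refine Finset.sum_congr rfl fun l _ => ?_
        rw [consOne_succ, hidx]; rfl
    · refine (Fin.prod_univ_succ _).trans ?_
      congr 1
      · rw [consOne_zero, hidx1]; rfl
      · refine Finset.prod_congr rfl fun l _ => ?_
        rw [consOne_succ, hidx]; rfl
  ext m
  rw [map_add, shiftSum, coeff_mkMv, shiftSum, coeff_mkMv]
  refine (tsum_splitFirst (summable_coeff_shiftTerm _ N ht hz m)).trans ?_
  congr 1
  · simp only [h1]; rfl
  · simp only [h2, MvPowerSeries.coeff_mul]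
    rw [Summable.tsum_finsetSum]
    · refine Finset.sum_congr rfl fun ij _ => ?_
      rw [shiftSum, coeff_mkMv, tsum_mul_left]
    · intro ij _
      exact (summable_coeff_shiftTerm w (N + 1) ht hz ij.2).mul_left _

/-- The value of `powerSum` at `(t, z)`: the power sum of the numbers `e^{(j + t)δz}`, `j > N`. -/
def powerValue (δ : ℕ+) (t : ℝ) (z : ℂ) (N k : ℕ) : ℂ :=
  Complex.exp ((δ : ℕ) * (t + N + 1) * z) ^ k / (1 - Complex.exp ((δ : ℕ) * z) ^ k)

theorem one_sub_exp_pow_ne_zero (δ : ℕ+) {z : ℂ} (hz : z.re < 0) (k : ℕ) :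
    1 - Complex.exp ((δ : ℕ) * z) ^ (k + 1) ≠ 0 := by
  intro h
  have h1 : ‖Complex.exp ((δ : ℕ) * z) ^ (k + 1)‖ < 1 := by
    rw [norm_pow, Complex.norm_exp]
    refine pow_lt_one₀ (Real.exp_pos _).le ?_ (by omega)
    rw [Real.exp_lt_one_iff]
    have : (0 : ℝ) < (δ : ℕ) := by exact_mod_cast δ.pos
    have h2 : (((δ : ℕ) : ℂ) * z).re = (δ : ℕ) * z.re := by simp
    rw [h2]
    exact mul_neg_of_pos_of_neg this hz
  rw [← sub_eq_zero.1 h] at h1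
  simp at h1

/-- For `α = (0, …, 0)` the regularized sum is an elementary symmetric function of the numbers
`e^{(j + t)δz}`, `j > N`, which form a geometric progression. -/
theorem coeff_zero_shiftSum_zeros (δ : ℕ+) (p N : ℕ) {t : ℝ} (ht : 0 ≤ t) {z : ℂ}
    (hz : z.re < 0) :
    MvPowerSeries.coeff 0 (shiftSum (List.replicate p (0, δ)) N t z) =
      newton (powerValue δ t z N) p := by
  refine eq_newton_of_qRecursion
    (e := fun p => MvPowerSeries.coeff 0 (shiftSum (List.replicate p (0, δ)) N t z))
    (one_sub_exp_pow_ne_zero δ hz) ?_ (fun p => ?_) p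
  · simp [shiftSum_nil]
  · have hshift : ∀ p, MvPowerSeries.coeff 0 (shiftSum (List.replicate p (0, δ)) (N + 1) t z) =
        Complex.exp ((δ : ℕ) * z) ^ p *
          MvPowerSeries.coeff 0 (shiftSum (List.replicate p (0, δ)) N t z) := by
      intro p
      rw [shiftSum, coeff_mkMv, shiftSum, coeff_mkMv, ← tsum_mul_left]
      refine tsum_congr fun i => ?_
      have hw : ∀ l, (List.replicate p ((0 : ℕ), δ)).get l = (0, δ) := fun l => by simp
      simp only [shiftTerm, hw, Finsupp.single_zero, Finset.sum_const_zero,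
        MvPowerSeries.coeff_monomial_same]
      have hc : Complex.exp ((δ : ℕ) * z) ^ p =
          ∏ _l : Fin (List.replicate p ((0 : ℕ), δ)).length, Complex.exp ((δ : ℕ) * z) := by
        simp
      rw [hc, ← Finset.prod_mul_distrib]
      refine Finset.prod_congr rfl fun l _ => ?_
      rw [← Complex.exp_add]
      congr 1
      simp [shiftIdx]
      ring
    have h := congrArg (MvPowerSeries.coeff 0)
      (shiftSum_cons 0 δ (List.replicate p (0, δ)) N ht hz)
    rw [← List.replicate_succ, map_add, hshift, stepValue, pow_zero, one_mul,
      MvPowerSeries.coeff_C_mul, hshift] at h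
    linear_combination h

end Sums

/-! ### Evaluation of formal Laurent series -/

section Evaluation

/-- Evaluation at a real number `t`, from `ℚ[[X]][t]` to `ℂ[[X]]`. -/
def evalT (t : ℝ) : PolyT ℚ →+* MvPowerSeries ℕ+ ℂ :=
  Polynomial.eval₂RingHom (MvPowerSeries.map (algebraMap ℚ ℂ)) (MvPowerSeries.C (t : ℂ))

theorem coeffAt_eq (F : LaurentT ℚ) (n : ℤ) (m : ℕ+ →₀ ℕ) (t : ℝ) :
    coeffAt F n m t = MvPowerSeries.coeff m (evalT t (F.coeff n)) := by
  rw [coeffAt, evalT, Polynomial.coe_eval₂RingHom, Polynomial.eval₂_eq_sum, Polynomial.sum_def,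
    Polynomial.sum_def, map_sum]
  refine Finset.sum_congr rfl fun s _ => ?_
  rw [← map_pow, MvPowerSeries.coeff_mul_C, MvPowerSeries.coeff_map]
  rfl

/-- The Laurent series `F` in `z` with coefficients in `ℚ[[X]][t]` converges at `(t, z)`,
coefficientwise in the monomials in `X`, with sum `q`. -/
def EvaluatesTo (t : ℝ) (z : ℂ) (F : LaurentT ℚ) (q : MvPowerSeries ℕ+ ℂ) : Prop :=
  ∀ m, HasSum (fun n : ℤ => MvPowerSeries.coeff m (evalT t (F.coeff n)) * z ^ n)
    (MvPowerSeries.coeff m q)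

variable {t : ℝ} {z : ℂ}

theorem EvaluatesTo.add {F G : LaurentT ℚ} {q r : MvPowerSeries ℕ+ ℂ}
    (hF : EvaluatesTo t z F q) (hG : EvaluatesTo t z G r) : EvaluatesTo t z (F + G) (q + r) := by
  intro m
  rw [map_add]
  exact ((hF m).add (hG m)).congr_fun fun n => by
    rw [HahnSeries.coeff_add, map_add, map_add, add_mul]

theorem EvaluatesTo.neg {F : LaurentT ℚ} {q : MvPowerSeries ℕ+ ℂ}
    (hF : EvaluatesTo t z F q) : EvaluatesTo t z (-F) (-q) := by
  intro m
  rw [map_neg]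
  exact (hF m).neg.congr_fun fun n => by
    rw [HahnSeries.coeff_neg, map_neg, map_neg, neg_mul]

theorem EvaluatesTo.mul {F G : LaurentT ℚ} {q r : MvPowerSeries ℕ+ ℂ} (hz : z ≠ 0)
    (hF : EvaluatesTo t z F q) (hG : EvaluatesTo t z G r) : EvaluatesTo t z (F * G) (q * r) := by
  classical
  intro m
  rw [MvPowerSeries.coeff_mul]
  have h : ∀ ab ∈ Finset.HasAntidiagonal.antidiagonal m, HasSum (fun n : ℤ =>
      (∑ ij ∈ Finset.antidiagonal F.isPWO_support G.isPWO_support n,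
        MvPowerSeries.coeff ab.1 (evalT t (F.coeff ij.1)) *
          MvPowerSeries.coeff ab.2 (evalT t (G.coeff ij.2))) * z ^ n)
      (MvPowerSeries.coeff ab.1 q * MvPowerSeries.coeff ab.2 r) := by
    intro ab _
    refine hasSum_laurent_mul
      (f := fun n => MvPowerSeries.coeff ab.1 (evalT t (F.coeff n)))
      (g := fun n => MvPowerSeries.coeff ab.2 (evalT t (G.coeff n)))
      (s := fun n => Finset.antidiagonal F.isPWO_support G.isPWO_support n)
      hz (hF ab.1) (hG ab.2) (fun n ij hij => ?_) (fun i j hij => ?_)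
    · exact (Finset.mem_antidiagonal.1 hij).2.2
    · by_contra h
      refine hij (Finset.mem_antidiagonal.2 ⟨fun h1 => h ?_, fun h1 => h ?_, rfl⟩) <;>
        simp only [h1, map_zero, zero_mul, mul_zero]
  refine (hasSum_sum h).congr_fun fun n => ?_
  rw [HahnSeries.coeff_mul, map_sum, map_sum, ← Finset.sum_mul, Finset.sum_comm]
  congr 1
  refine Finset.sum_congr rfl fun ij _ => ?_
  rw [map_mul, MvPowerSeries.coeff_mul]

theorem evaluatesTo_single (n : ℤ) (a : PolyT ℚ) :
    EvaluatesTo t z (HahnSeries.single n a) (evalT t a * MvPowerSeries.C (z ^ n)) := by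
  intro m
  rw [MvPowerSeries.coeff_mul_C]
  refine (hasSum_ite_eq n _).congr_fun fun n' => ?_
  by_cases h : n' = n
  · subst h
    rw [if_pos rfl, HahnSeries.coeff_single_same]
  · rw [if_neg h, HahnSeries.coeff_single_of_ne h, map_zero, map_zero, zero_mul]

theorem evaluatesTo_C (a : PolyT ℚ) : EvaluatesTo t z (HahnSeries.C a) (evalT t a) := by
  have := evaluatesTo_single (t := t) (z := z) 0 a
  rwa [zpow_zero, map_one, mul_one] at this

theorem EvaluatesTo.sum {ι : Type*} {s : Finset ι} {F : ι → LaurentT ℚ}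
    {q : ι → MvPowerSeries ℕ+ ℂ} (h : ∀ i ∈ s, EvaluatesTo t z (F i) (q i)) :
    EvaluatesTo t z (∑ i ∈ s, F i) (∑ i ∈ s, q i) := by
  intro m
  rw [map_sum]
  refine (hasSum_sum fun i hi => h i hi m).congr_fun fun n => ?_
  rw [HahnSeries.coeff_sum, map_sum, map_sum, Finset.sum_mul]

theorem evaluatesTo_ofPowerSeries {f : PowerSeries (PolyT ℚ)} {c : ℕ → ℂ} {a : ℂ}
    (hf : ∀ n, evalT t (PowerSeries.coeff n f) = MvPowerSeries.C (c n))
    (h : HasSum (fun n => c n * z ^ n) a) :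
    EvaluatesTo t z (HahnSeries.ofPowerSeries ℤ _ f) (MvPowerSeries.C a) := by
  classical
  intro m
  refine hasSum_int_of_nat (fun n hn => ?_) ?_
  · rw [PowerSeries.coeff_coe, if_pos hn, map_zero, map_zero, zero_mul]
  · rw [MvPowerSeries.coeff_C]
    by_cases hm : m = 0
    · rw [if_pos hm]
      refine h.congr_fun fun n => ?_
      rw [PowerSeries.coeff_coe, if_neg (by omega), Int.natAbs_natCast, zpow_natCast, hf,
        MvPowerSeries.coeff_C, if_pos hm]
    · rw [if_neg hm]
      refine hasSum_zero.congr_fun fun n => ?_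
      rw [PowerSeries.coeff_coe, if_neg (by omega), Int.natAbs_natCast, zpow_natCast, hf,
        MvPowerSeries.coeff_C, if_neg hm, zero_mul]

theorem evalT_rat (c : ℚ) : evalT t (algebraMap ℚ (PolyT ℚ) c) = MvPowerSeries.C (c : ℂ) := by
  change Polynomial.eval₂ _ _ (Polynomial.C (MvPowerSeries.C c)) = _
  rw [Polynomial.eval₂_C, MvPowerSeries.map_C]
  rfl

theorem evalT_X_add (N : ℕ) :
    evalT t (Polynomial.X + (N : PolyT ℚ) + 1) = MvPowerSeries.C ((t : ℂ) + N + 1) := by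
  rw [map_add, map_add, map_one, map_natCast, map_add, map_add, map_one, map_natCast]
  congr 2
  exact Polynomial.eval₂_X _ _

theorem evalT_smul (c : ℚ) (a : PolyT ℚ) :
    evalT t (c • a) = MvPowerSeries.C (c : ℂ) * evalT t a := by
  rw [Algebra.smul_def, map_mul, evalT_rat]

theorem EvaluatesTo.newton (hz : z ≠ 0) {P : ℕ → LaurentT ℚ} {P' : ℕ → MvPowerSeries ℕ+ ℂ}
    (p : ℕ) (h : ∀ k, k < p → EvaluatesTo t z (P (k + 1)) (P' (k + 1))) :
    EvaluatesTo t z (newton P p) (newton P' p) := by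
  induction p using Nat.strong_induction_on with
  | _ p ih =>
    cases p with
    | zero =>
      rw [newton_zero, newton_zero]
      have := evaluatesTo_C (t := t) (z := z) 1
      rwa [map_one, map_one] at this
    | succ p =>
      rw [newton_succ_mul ((HahnSeries.C).comp (algebraMap ℚ (PolyT ℚ))),
        newton_succ_mul ((evalT t).comp (algebraMap ℚ (PolyT ℚ))), RingHom.comp_apply,
        RingHom.comp_apply]
      refine (evaluatesTo_C _).mul hz (EvaluatesTo.sum fun ij hij => ?_)
      have h1 := Finset.HasAntidiagonal.mem_antidiagonal.1 hij
      have h2 := (h ij.1 (by omega)).mul hz (ih ij.2 (by omega) fun k hk => h k (by omega))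
      rw [mul_assoc, mul_assoc]
      rcases neg_one_pow_mul_eq_or ij.1 with h3 | h3
      · rw [h3, h3]
        exact h2
      · rw [h3, h3]
        exact h2.neg

theorem EvaluatesTo.tower {A : Type*} (hz : z ≠ 0) {x : ℕ → A → LaurentT ℚ}
    {x' : ℕ → A → MvPowerSeries ℕ+ ℂ} {f : ℕ → List A → LaurentT ℚ}
    {f' : ℕ → List A → MvPowerSeries ℕ+ ℂ} (hx : ∀ N a, EvaluatesTo t z (x N a) (x' N a))
    {K n : ℕ} (hf : ∀ w : List A, w.length ≤ n → EvaluatesTo t z (f K w) (f' K w)) (d : ℕ) :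
    ∀ N, N + d = K → ∀ w : List A, w.length ≤ n →
      EvaluatesTo t z (tower x f d N w) (tower x' f' d N w) := by
  induction d with
  | zero => intro N hN w hw; subst hN; exact hf w hw
  | succ d ih =>
    intro N hN w hw
    have ih := ih (N + 1) (by omega)
    cases w with
    | nil => exact ih [] hw
    | cons a w =>
      exact (ih _ hw).add ((hx N a).mul hz (ih w (by rw [List.length_cons] at hw; omega)))

theorem evaluatesTo_stepSeries (δ : ℕ+) (hz : z ≠ 0) (N a : ℕ) :
    EvaluatesTo t z (HahnSeries.ofPowerSeries ℤ _ (stepSeries δ N a)) (stepValue δ t z N a) := by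
  rw [stepSeries, map_mul, HahnSeries.ofPowerSeries_C]
  have hX : evalT t (Polynomial.C (MvPowerSeries.X N.succPNat ^ a)) =
      MvPowerSeries.X N.succPNat ^ a := by
    rw [map_pow, map_pow]
    congr 1
    change Polynomial.eval₂ _ _ _ = _
    rw [Polynomial.eval₂_C, MvPowerSeries.map_X]
  have h1 := evaluatesTo_C (t := t) (z := z) (Polynomial.C (MvPowerSeries.X N.succPNat ^ a))
  rw [hX] at h1
  refine h1.mul hz (evaluatesTo_ofPowerSeries
    (c := fun n => ((n.factorial : ℂ))⁻¹ * ((δ : ℕ) * ((t : ℂ) + N + 1)) ^ n) (fun n => ?_) ?_)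
  · rw [expSeries, PowerSeries.coeff_rescale, PowerSeries.coeff_exp, map_mul, map_pow, map_mul,
      evalT_X_add, map_natCast, evalT_rat, mul_comm]
    simp
  · refine (hasSum_exp ((δ : ℕ) * (t + N + 1) * z)).congr_fun fun n => ?_
    rw [mul_pow _ z]
    ring

theorem evaluatesTo_powerSum (δ : ℕ+) (N k : ℕ) (hk : k ≠ 0) (t : ℝ) :
    ∀ᶠ z : ℂ in 𝓝[{z : ℂ | z.re < 0}] 0,
      EvaluatesTo t z (powerSum δ N k) (MvPowerSeries.C (powerValue δ t z N k)) := by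
  set x : ℂ := (t : ℂ) + N + 1 with hx
  obtain ⟨κ, hκ⟩ : ∃ κ : ℂ, κ = (k : ℂ) * (δ : ℕ) := ⟨_, rfl⟩
  have hκ0 : κ ≠ 0 := by
    have : ((δ : ℕ) : ℂ) ≠ 0 := by exact_mod_cast δ.ne_zero
    rw [hκ]
    exact mul_ne_zero (by exact_mod_cast hk) this
  have hle : Tendsto (fun z : ℂ => κ * z) (𝓝[{z : ℂ | z.re < 0}] 0) (𝓝[≠] 0) := by
    refine tendsto_nhdsWithin_iff.2 ⟨?_, ?_⟩
    · have : Tendsto (fun z : ℂ => κ * z) (𝓝 0) (𝓝 (κ * 0)) :=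
        (continuous_const_mul κ).tendsto 0
      rw [mul_zero] at this
      exact this.mono_left nhdsWithin_le_nhds
    · filter_upwards [self_mem_nhdsWithin] with z hz h
      have hz : z.re < 0 := hz
      rcases mul_eq_zero.1 h with h | h
      · exact hκ0 h
      · simp [h] at hz
  filter_upwards [hle.eventually (hasSum_bernoulli_near_zero x), self_mem_nhdsWithin] with z hB hz
  have hz : z.re < 0 := hz
  have hz0 : z ≠ 0 := by rintro rfl; simp at hz
  have hu0 : κ * z ≠ 0 := mul_ne_zero hκ0 hz0
  have hne : Complex.exp (κ * z) - 1 ≠ 0 := by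
    have h1 := one_sub_exp_pow_ne_zero δ hz (k - 1)
    rw [Nat.sub_add_cancel (Nat.pos_of_ne_zero hk), ← Complex.exp_nat_mul, ← mul_assoc] at h1
    intro h
    exact h1 (by rw [← hκ]; linear_combination -h)
  have hhol : EvaluatesTo t z (HahnSeries.ofPowerSeries ℤ _ (holSeries δ N k))
      (MvPowerSeries.C (-((κ * z * Complex.exp (x * (κ * z)) / (Complex.exp (κ * z) - 1) - 1) /
        (κ * z)))) := by
    refine evaluatesTo_ofPowerSeries (c := fun n => -(κ ^ n / (n + 1).factorial *
      aeval x (Polynomial.bernoulli (n + 1)))) (fun n => ?_) ?_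
    · rw [holSeries, PowerSeries.coeff_mk, map_neg, evalT_smul, map_neg, map_mul]
      congr 2
      · rw [hκ]
        push_cast
        rfl
      · have h1 : evalT t (aeval (Polynomial.X + (N : PolyT ℚ) + 1)
            (Polynomial.bernoulli (n + 1))) =
            Polynomial.eval₂ ((evalT t).comp (algebraMap ℚ _)) (MvPowerSeries.C x)
              (Polynomial.bernoulli (n + 1)) := by
          rw [Polynomial.aeval_def, Polynomial.hom_eval₂, evalT_X_add]
        rw [h1, Polynomial.aeval_def, Polynomial.hom_eval₂]
        congr 1
        exact Subsingleton.elim _ _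
    · have h2 := (hasSum_nat_add_iff' 1).2 hB
      have h3 := (h2.div_const (κ * z)).neg
      simp only [Finset.range_one, Finset.sum_singleton, pow_zero, mul_one, Nat.factorial_zero,
        Nat.cast_one, div_one, one_smul, Polynomial.bernoulli_zero, map_one] at h3
      refine h3.congr_fun fun n => ?_
      rw [map_smul, Algebra.smul_def, pow_succ (κ * z)]
      have hcast : algebraMap ℚ ℂ (1 / ((n + 1).factorial : ℚ)) = 1 / ((n + 1).factorial : ℂ) := by
        simp
      rw [hcast, mul_pow]
      field_simp
  have hpole : EvaluatesTo t z (pole δ k) (MvPowerSeries.C ((κ * z)⁻¹)) := by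
    have := evaluatesTo_single (t := t) (z := z) (-1)
      (algebraMap ℚ (PolyT ℚ) ((k : ℚ) * (δ : ℕ))⁻¹)
    rw [evalT_rat, ← map_mul] at this
    have e : (κ * z)⁻¹ = (((k : ℚ) * (δ : ℕ))⁻¹ : ℚ) * z ^ (-1 : ℤ) := by
      rw [zpow_neg_one, mul_inv, hκ]
      push_cast
      rfl
    rw [e]
    exact this
  have h := hhol.add hpole.neg
  rw [← map_neg, ← map_add] at h
  rw [powerSum]
  convert h using 1
  · exact sub_eq_add_neg (G := LaurentT ℚ) _ _
  · congr 1
    rw [powerValue, ← Complex.exp_nat_mul, ← Complex.exp_nat_mul]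
    have e1 : (k : ℂ) * (((δ : ℕ) : ℂ) * (t + N + 1) * z) = x * (κ * z) := by rw [hx, hκ]; ring
    have e2 : (k : ℂ) * (((δ : ℕ) : ℂ) * z) = κ * z := by rw [hκ]; ring
    rw [e1, e2]
    have hne' : 1 - Complex.exp (κ * z) ≠ 0 := fun h => hne (by linear_combination -h)
    rw [← neg_sub (Complex.exp (κ * z)) 1]
    field_simp
    ring

/-- The value at `(t, z)` of `formalReg`. -/
def towerValue (δ : ℕ+) (t : ℝ) (z : ℂ) (d N : ℕ) (α : List ℕ) : MvPowerSeries ℕ+ ℂ :=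
  tower (stepValue δ t z)
    (fun N => onZeros (newton fun k => MvPowerSeries.C (powerValue δ t z N k))) d N α

theorem evaluatesTo_formalReg (δ : ℕ+) (t : ℝ) (K : ℕ) (α : List ℕ) :
    ∀ᶠ z : ℂ in 𝓝[{z : ℂ | z.re < 0}] 0,
      EvaluatesTo t z (formalReg δ K 0 α) (towerValue δ t z K 0 α) := by
  have h : ∀ᶠ z : ℂ in 𝓝[{z : ℂ | z.re < 0}] 0, ∀ k ∈ Finset.range α.length,
      EvaluatesTo t z (powerSum δ K (k + 1)) (MvPowerSeries.C (powerValue δ t z K (k + 1))) :=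
    (Filter.eventually_all_finset _).2 fun k _ => evaluatesTo_powerSum δ K (k + 1) (by omega) t
  filter_upwards [h, self_mem_nhdsWithin] with z hz hz'
  have hz' : z.re < 0 := hz'
  have hz0 : z ≠ 0 := by rintro rfl; simp at hz'
  refine EvaluatesTo.tower (n := α.length) hz0 (fun N a => evaluatesTo_stepSeries δ hz0 N a)
    (fun w hw => ?_) K 0 (Nat.zero_add K) α le_rfl
  rw [onZeros, onZeros]
  split_ifs
  · exact EvaluatesTo.newton hz0 _ fun k hk => hz k (Finset.mem_range.2 (by omega))
  · have := evaluatesTo_C (t := t) (z := z) 0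
    rwa [map_zero, map_zero] at this

/-- The directed weak composition `(α, (δ, …, δ))`. -/
def word (δ : ℕ+) (α : List ℕ) : List (ℕ × ℕ+) := α.map fun a => (a, δ)

/-- Modulo the variables `x_i`, `i > N`, only the words `(0, …, 0)` contribute to the sum over
the indices above `N`. -/
theorem truncVars_shiftSum (δ : ℕ+) (N : ℕ) (α : List ℕ) (ht : 0 ≤ t) (hz : z.re < 0) :
    truncVars ℂ N (shiftSum (word δ α) N t z) =
      truncVars ℂ N (onZeros (newton fun k => MvPowerSeries.C (powerValue δ t z N k)) α) := by
  classical
  ext m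
  rw [coeff_truncVars, coeff_truncVars]
  split_ifs with hm
  · rw [onZeros]
    split_ifs with hα
    · rw [← map_newton (R := ℂ) (S := MvPowerSeries ℕ+ ℂ) MvPowerSeries.C,
        ← coeff_zero_shiftSum_zeros δ _ N ht hz,
        MvPowerSeries.coeff_C]
      have hw : word δ α = List.replicate α.length (0, δ) := by
        rw [List.eq_replicate_iff.2 ⟨rfl, hα⟩, word, List.map_replicate, List.length_replicate]
      rw [hw]
      by_cases h0 : m = 0
      · rw [if_pos h0, h0]
      · rw [if_neg h0, shiftSum, coeff_mkMv]
        refine (tsum_congr fun i => ?_).trans tsum_zero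
        rw [shiftTerm, MvPowerSeries.coeff_monomial, if_neg]
        simpa using h0
    · rw [map_zero, shiftSum, coeff_mkMv]
      refine (tsum_congr fun i => ?_).trans tsum_zero
      rw [shiftTerm, MvPowerSeries.coeff_monomial, if_neg]
      rintro rfl
      push Not at hα
      obtain ⟨a, ha, ha0⟩ := hα
      obtain ⟨l, hl⟩ := List.mem_iff_get.1 (List.mem_map_of_mem (f := fun a => (a, δ)) ha)
      -- A positive letter puts the variable with index `i l + N > N` into the monomial.
      have h1 := hm (shiftIdx N (i l)) (by
        rw [Finsupp.mem_support_iff, Finsupp.finsetSum_apply]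
        refine (Finset.sum_pos' (fun _ _ => Nat.zero_le _) ⟨l, Finset.mem_univ _, ?_⟩).ne'
        rw [Finsupp.single_eq_same]
        have : ((word δ α).get l).1 = a := congrArg Prod.fst hl
        rw [this]
        exact Nat.pos_of_ne_zero ha0)
      have h2 := (i l).pos
      change (i l : ℕ) + N ≤ N at h1
      omega
  · rfl

/-- Modulo the variables `x_i`, `i > K`, the regularized sum is the value of `formalReg`. -/
theorem truncVars_shiftSum_zero (δ : ℕ+) (K : ℕ) (α : List ℕ) (ht : 0 ≤ t) (hz : z.re < 0) :
    truncVars ℂ K (shiftSum (word δ α) 0 t z) = truncVars ℂ K (towerValue δ t z K 0 α) := by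
  have h : ∀ d N (α : List ℕ), shiftSum (word δ α) N t z =
      tower (stepValue δ t z) (fun N α => shiftSum (word δ α) N t z) d N α := by
    intro d
    induction d with
    | zero => intro N α; rfl
    | succ d ih =>
      intro N α
      cases α with
      | nil =>
        rw [tower, step, ← ih]
        exact (shiftSum_nil N t z).trans (shiftSum_nil (N + 1) t z).symm
      | cons a α =>
        rw [tower, step, ← ih, ← ih]
        exact shiftSum_cons a δ (word δ α) N ht hz
  have hcongr : ∀ {x : ℕ → ℕ → MvPowerSeries ℕ+ ℂ} {f g : ℕ → List ℕ → MvPowerSeries ℕ+ ℂ}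
      (d N : ℕ) (_ : f (N + d) = g (N + d)), tower x f d N = tower x g d N := by
    intro x f g d
    induction d with
    | zero => intro N h; exact h
    | succ d ih =>
      intro N h
      rw [tower, tower, ih (N + 1) (by rwa [show N + 1 + d = N + (d + 1) by omega])]
  rw [h K 0 α, towerValue, map_tower (truncVars ℂ K), map_tower (truncVars ℂ K)]
  refine congrFun (hcongr K 0 ?_) α
  funext α
  rw [Nat.zero_add]
  exact truncVars_shiftSum δ K α ht hz

end Evaluation

instance neBot_nhdsWithin_re_neg : (𝓝[{z : ℂ | z.re < 0}] (0 : ℂ)).NeBot := by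
  rw [← mem_closure_iff_nhdsWithin_neBot, Metric.mem_closure_iff]
  intro ε hε
  refine ⟨((-(ε / 2) : ℝ) : ℂ), by simpa using hε, ?_⟩
  rw [dist_zero_left, Complex.norm_real, Real.norm_eq_abs, abs_neg, abs_of_pos (by positivity)]
  linarith

/-- The coefficient of `x^m` in an element of `ℚ[[X]][t]`, as a polynomial in `t` over `ℂ`. -/
def coeffPoly (m : ℕ+ →₀ ℕ) (p : PolyT ℚ) : Polynomial ℂ :=
  p.sum fun s a => Polynomial.monomial s ((MvPowerSeries.coeff m a : ℚ) : ℂ)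

theorem coeff_coeffPoly (m : ℕ+ →₀ ℕ) (p : PolyT ℚ) (s : ℕ) :
    (coeffPoly m p).coeff s = ((MvPowerSeries.coeff m (p.coeff s) : ℚ) : ℂ) := by
  simp only [coeffPoly, Polynomial.sum_def, Polynomial.finsetSum_coeff, Polynomial.coeff_monomial,
    Finset.sum_ite_eq']
  split_ifs with h
  · rfl
  · rw [Polynomial.notMem_support_iff] at h
    simp [h]

theorem eval_coeffPoly (F : LaurentT ℚ) (n : ℤ) (m : ℕ+ →₀ ℕ) (t : ℝ) :
    (coeffPoly m (F.coeff n)).eval (t : ℂ) = coeffAt F n m t := by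
  simp only [coeffPoly, coeffAt, Polynomial.sum_def, Polynomial.eval_finsetSum,
    Polynomial.eval_monomial]

/-- Uniqueness of the expansion in `ℚ[[X]][t][z⁻¹, z]]`, one monomial in `X` at a time. -/
theorem coeff_eq_of_hasSum {F G : LaurentT ℚ} {m : ℕ+ →₀ ℕ} {g : ℝ → ℂ → ℂ}
    (hF : ∀ t : ℝ, 0 ≤ t → ∀ᶠ z : ℂ in 𝓝[{z : ℂ | z.re < 0}] 0,
      HasSum (fun n : ℤ => coeffAt F n m t * z ^ n) (g t z))
    (hG : ∀ t : ℝ, 0 ≤ t → ∀ᶠ z : ℂ in 𝓝[{z : ℂ | z.re < 0}] 0,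
      HasSum (fun n : ℤ => coeffAt G n m t * z ^ n) (g t z)) (n : ℤ) (s : ℕ) :
    MvPowerSeries.coeff m ((F.coeff n).coeff s) = MvPowerSeries.coeff m ((G.coeff n).coeff s) := by
  have hl : 𝓝[{z : ℂ | z.re < 0}] (0 : ℂ) ≤ 𝓝[≠] 0 := by
    refine nhdsWithin_mono _ fun z hz h => ?_
    have hz : z.re < 0 := hz
    rw [Set.mem_singleton_iff] at h
    simp [h] at hz
  have h1 : ∀ t : ℝ, 0 ≤ t → coeffAt F n m t = coeffAt G n m t := by
    intro t ht
    let e : LaurentT ℚ → LaurentSeries ℂ := fun H =>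
      H.map ((MvPowerSeries.coeff m).toAddMonoidHom.comp (evalT t).toAddMonoidHom)
    have he : ∀ H n, (e H).coeff n = coeffAt H n m t := fun H n => (coeffAt_eq H n m t).symm
    have := eq_of_convergesTo hl (G := e F) (H := e G) (g := g t)
      ((hF t ht).mono fun z hz => by simpa only [ConvergesTo, he] using hz)
      ((hG t ht).mono fun z hz => by simpa only [ConvergesTo, he] using hz)
    rw [← he, ← he, this]
  have hPP : coeffPoly m (F.coeff n) = coeffPoly m (G.coeff n) := by
    refine Polynomial.eq_of_infinite_eval_eq _ _
      ((Set.infinite_range_of_injective (Nat.cast_injective (R := ℂ))).mono ?_)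
    rintro _ ⟨j, rfl⟩
    have := h1 j (Nat.cast_nonneg j)
    rw [← eval_coeffPoly, ← eval_coeffPoly] at this
    simpa using! this
  have := congrArg (fun p => Polynomial.coeff p s) hPP
  simp only [coeff_coeffPoly] at this
  exact_mod_cast this

/-- The regularization of a word with constant direction exists, and its truncations to finitely
many variables are given by `formalReg`. -/
theorem truncLaurent_regularizationRat (δ : ℕ+) (N : ℕ) (α : List ℕ) :
    truncLaurent ℚ N (regularizationRat (word δ α)) = truncLaurent ℚ N (formalReg δ N 0 α) := by
  have hval : ∀ (m : ℕ+ →₀ ℕ) (K : ℕ), varBound m ≤ K → ∀ t : ℝ, 0 ≤ t →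
      ∀ᶠ z : ℂ in 𝓝[{z : ℂ | z.re < 0}] 0,
        HasSum (fun n : ℤ => coeffAt (formalReg δ K 0 α) n m t * z ^ n)
          (∑' i, MvPowerSeries.coeff m (regTerm (word δ α) t z i)) := by
    intro m K hK t ht
    filter_upwards [evaluatesTo_formalReg δ t K α, self_mem_nhdsWithin] with z hz hz'
    have h := hz m
    have h1 := congrArg (MvPowerSeries.coeff m) (truncVars_shiftSum_zero δ K α ht hz')
    rw [coeff_truncVars_of_le hK, coeff_truncVars_of_le hK] at h1
    rw [← h1] at h
    simp only [coeffAt_eq]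
    exact h
  -- The coefficient of `x^m` is taken from the model with just enough variables.
  obtain ⟨F, hF⟩ := exists_laurentT_of_degBound (fun m => formalReg δ (varBound m) 0 α)
    (p := α.length) fun m => degBound_formalReg δ _ 0 α
  have hco : ∀ (G H : LaurentT ℚ) (m : ℕ+ →₀ ℕ), (∀ n s, MvPowerSeries.coeff m
      ((G.coeff n).coeff s) = MvPowerSeries.coeff m ((H.coeff n).coeff s)) →
      ∀ n t, coeffAt G n m t = coeffAt H n m t := by
    intro G H m h n t
    have hp : coeffPoly m (G.coeff n) = coeffPoly m (H.coeff n) := by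
      ext1 s
      rw [coeff_coeffPoly, coeff_coeffPoly, h]
    rw [← eval_coeffPoly, ← eval_coeffPoly, hp]
  have hreg : IsRegularization (word δ α) F := by
    intro m t ht
    refine ⟨fun z hz => summable_coeff_shiftTerm (word δ α) 0 ht hz m, ?_⟩
    filter_upwards [hval m _ le_rfl t ht] with z hz
    simpa only [hco F _ m (hF m)] using hz
  have hspec : IsRegularization (word δ α) (regularizationRat (word δ α)) :=
    Classical.epsilon_spec ⟨F, hreg⟩
  refine HahnSeries.ext (funext fun n => Polynomial.ext fun s => MvPowerSeries.ext fun m => ?_)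
  rw [coeff_laurentMap, coeff_laurentMap]
  rw [Polynomial.coe_mapRingHom, Polynomial.coeff_map, Polynomial.coeff_map, coeff_truncVars,
    coeff_truncVars]
  split_ifs with hm
  · exact coeff_eq_of_hasSum (fun t ht => (hspec m t ht).2)
      (hval m N (varBound_le_iff.2 hm)) n s
  · rfl

/-! ### Birkhoff factorization in constant direction -/

section Birkhoff

/-- The component `φ₊` of the Birkhoff factorization over `ℚ`, on words with constant direction
`δ`, as the convolution of the regularization and the counterterm. -/
def birkhoffPlus (δ : ℕ+) (α : List ℕ) : LaurentT ℚ :=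
  conv (fun α => regularizationRat (word δ α)) (counterterm δ) α

theorem truncLaurent_birkhoffPlus (δ : ℕ+) (N : ℕ) (α : List ℕ) :
    truncLaurent ℚ N (birkhoffPlus δ α) =
      truncLaurent ℚ N (conv (formalReg δ N 0) (counterterm δ) α) := by
  rw [birkhoffPlus, map_conv (R := LaurentT ℚ) (S := LaurentT ℚ) (truncLaurent ℚ N),
    map_conv (R := LaurentT ℚ) (S := LaurentT ℚ) (truncLaurent ℚ N)]
  simp only [truncLaurent_regularizationRat]

theorem mapTrunc_coeff_birkhoffPlus (δ : ℕ+) (N : ℕ) (α : List ℕ) (n : ℤ) :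
    Polynomial.mapRingHom (truncVars ℚ N) ((birkhoffPlus δ α).coeff n) =
      Polynomial.mapRingHom (truncVars ℚ N)
        ((conv (formalReg δ N 0) (counterterm δ) α).coeff n) :=
  congrArg (fun F : LaurentT ℚ => F.coeff n) (truncLaurent_birkhoffPlus δ N α)

theorem coeff_birkhoffPlus_of_neg (δ : ℕ+) (α : List ℕ) {n : ℤ} (hn : n < 0) :
    (birkhoffPlus δ α).coeff n = 0 :=
  polyT_ext fun N => by
    rw [mapTrunc_coeff_birkhoffPlus, coeff_conv_formalReg_of_neg δ N 0 α hn]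

theorem regularizationRat_nil : regularizationRat [] = 1 := by
  have h1 : ∀ d N, formalReg 1 d N [] = 1 := by
    intro d
    induction d with
    | zero => intro N; simp [formalReg, tower, onZeros, newton_zero]
    | succ d ih => intro N; exact ih (N + 1)
  refine HahnSeries.ext (funext fun n => polyT_ext fun N => ?_)
  have := truncLaurent_regularizationRat 1 N []
  rw [h1] at this
  exact congrArg (fun F : LaurentT ℚ => F.coeff n) this

theorem counterterm_nil (δ : ℕ+) : counterterm δ [] = 1 := by
  simp [counterterm, onZeros, newton_zero]

theorem birkhoffPlus_nil (δ : ℕ+) : birkhoffPlus δ [] = 1 := by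
  simp [birkhoffPlus, conv, counterterm_nil, word, regularizationRat_nil]

theorem birkhoffPlus_cons (δ : ℕ+) (a : ℕ) (α : List ℕ) :
    birkhoffPlus δ (a :: α) = counterterm δ (a :: α) + (regularizationRat (word δ (a :: α)) +
      ∑ i ∈ Finset.range α.length,
        regularizationRat (word δ (a :: α.take i)) * counterterm δ (α.drop i)) := by
  rw [birkhoffPlus, conv_cons, conv, Finset.sum_range_succ]
  simp only [List.take_length, List.drop_length, counterterm_nil, word, List.map_nil,
    regularizationRat_nil]
  ring

variable (k : Type*) [CommRing k] [Algebra ℚ k]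

/-- The base change from `ℚ[[X]][t]` to `k[[X]][t]`. -/
abbrev baseChange : PolyT ℚ →+* PolyT k :=
  Polynomial.mapRingHom (MvPowerSeries.map (algebraMap ℚ k))

theorem regularization_eq (w : List (ℕ × ℕ+)) :
    regularization k w = laurentMap (baseChange k) (regularizationRat w) := rfl

theorem regularization_add_sum (δ : ℕ+) (a : ℕ) (α : List ℕ)
    (h : ∀ i < α.length, phiMinus k ((word δ α).drop i) =
      laurentMap (baseChange k) (counterterm δ (α.drop i))) :
    regularization k ((a, δ) :: word δ α) + ∑ i : Fin (word δ α).length,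
        regularization k ((a, δ) :: (word δ α).take i) * phiMinus k ((word δ α).drop i) =
      laurentMap (baseChange k) (birkhoffPlus δ (a :: α)) -
        laurentMap (baseChange k) (counterterm δ (a :: α)) := by
  have hlen : (word δ α).length = α.length := List.length_map _
  rw [birkhoffPlus_cons, map_add, add_sub_cancel_left, map_add, map_sum,
    ← Fin.sum_univ_eq_sum_range (fun i => laurentMap (baseChange k)
      (regularizationRat (word δ (a :: α.take i)) * counterterm δ (α.drop i))) α.length, ← hlen]
  congr 1
  refine Finset.sum_congr rfl fun i _ => ?_
  rw [map_mul, h i (by rw [← hlen]; exact i.2), regularization_eq]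
  simp only [word, List.map_cons, List.map_take]

theorem polarPart_sub_counterterm (δ : ℕ+) (a : ℕ) (α : List ℕ) :
    polarPart (laurentMap (baseChange k) (birkhoffPlus δ (a :: α)) -
      laurentMap (baseChange k) (counterterm δ (a :: α))) =
    -laurentMap (baseChange k) (counterterm δ (a :: α)) := by
  refine HahnSeries.ext (funext fun n => ?_)
  rw [polarPart, HahnSeries.coeff_truncLT, HahnSeries.coeff_neg, HahnSeries.coeff_sub,
    coeff_laurentMap, coeff_laurentMap]
  split_ifs with hn
  · rw [coeff_birkhoffPlus_of_neg δ _ hn, map_zero, zero_sub]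
  · rw [coeff_counterterm_of_nonneg δ (List.cons_ne_nil a α) (not_lt.1 hn), map_zero, neg_zero]

/-- The counterterm is the component `φ₋`: its convolution with the regularization is holomorphic,
and it is polar on nonempty words, which characterizes the Birkhoff factorization. -/
theorem phiMinus_word (δ : ℕ+) (α : List ℕ) :
    phiMinus k (word δ α) = laurentMap (baseChange k) (counterterm δ α) := by
  induction hn : α.length using Nat.strong_induction_on generalizing α with
  | _ n ih =>
    cases α with
    | nil => rw [counterterm_nil, map_one, word, List.map_nil, phiMinus]
    | cons a α =>
      change phiMinus k ((a, δ) :: word δ α) = _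
      rw [phiMinus, regularization_add_sum k δ a α fun i hi => ?_, polarPart_sub_counterterm]
      · exact neg_neg (G := LaurentT k) _
      rw [← ih _ _ (α.drop i) rfl, word, word, List.map_drop]
      rw [← hn, List.length_drop, List.length_cons]
      omega

theorem phiPlus_word (δ : ℕ+) (α : List ℕ) :
    phiPlus k (word δ α) = laurentMap (baseChange k) (birkhoffPlus δ α) := by
  cases α with
  | nil => rw [birkhoffPlus_nil, map_one]; rfl
  | cons a α =>
    change phiPlus k ((a, δ) :: word δ α) = _
    simp only [phiPlus]
    rw [regularization_add_sum k δ a α fun i _ => ?_, polarPart_sub_counterterm]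
    · exact (sub_neg_eq_add (α := LaurentT k) _ _).trans (sub_add_cancel (G := LaurentT k) _ _)
    rw [← phiMinus_word, word, word, List.map_drop]

theorem renM_eq (δ : ℕ+) (α : List ℕ) :
    renM k δ α = baseChange k ((birkhoffPlus δ α).coeff 0) := by
  change (phiPlus k (word δ α)).coeff 0 = _
  rw [phiPlus_word, coeff_laurentMap]

/-- Modulo the variables `x_i`, `i > N`, the renormalized function `M_α` is `renTower N 0 α`. -/
theorem mapTrunc_constantTerm (δ : ℕ+) (N : ℕ) (α : List ℕ) :
    Polynomial.mapRingHom (truncVars ℚ N) ((birkhoffPlus δ α).coeff 0) =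
      Polynomial.mapRingHom (truncVars ℚ N) (renTower N 0 α) := by
  rw [mapTrunc_coeff_birkhoffPlus, coeff_zero_conv_formalReg]

theorem renM_eq_renM (δ δ' : ℕ+) (α : List ℕ) : renM k δ α = renM k δ' α := by
  rw [renM_eq, renM_eq]
  congr 1
  exact polyT_ext fun N => by rw [mapTrunc_constantTerm, mapTrunc_constantTerm]

theorem isStuffleChar_renM (δ : ℕ+) : IsStuffleChar (renM k δ) := by
  have h : IsStuffleChar fun α => (birkhoffPlus δ α).coeff 0 := by
    refine ⟨by rw [birkhoffPlus_nil]; simp, fun a b => polyT_ext fun N => ?_⟩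
    rw [map_mul, map_stuffleEval]
    simp only [mapTrunc_constantTerm]
    exact ((isStuffleChar_renTower N 0).map _).mul a b
  have := h.map (baseChange k)
  simpa only [← renM_eq] using this

theorem exists_subalgebra_renQSym (δ : ℕ+) :
    ∃ S : Subalgebra k (PolyT k), (S : Set (PolyT k)) = renQSym k δ := by
  have hchar := isStuffleChar_renM k δ
  have hmul : ∀ x ∈ renQSym k δ, ∀ y ∈ renQSym k δ, x * y ∈ renQSym k δ := by
    intro x hx y hy
    refine Submodule.span_induction₂ (p := fun x y _ _ => x * y ∈ renQSym k δ)
      ?_ ?_ ?_ ?_ ?_ ?_ ?_ hx hy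
    · rintro _ _ ⟨a, rfl⟩ ⟨b, rfl⟩
      rw [hchar.mul, ← linearCombination_quasiShuffle k, renQSym,
        ← Finsupp.range_linearCombination]
      exact ⟨_, rfl⟩
    · intro y _; simp
    · intro x _; simp
    · intro x y z _ _ _ h1 h2
      rw [add_mul]; exact Submodule.add_mem _ h1 h2
    · intro x y z _ _ _ h1 h2
      rw [mul_add]; exact Submodule.add_mem _ h1 h2
    · intro r x y _ _ h
      rw [smul_mul_assoc]; exact Submodule.smul_mem _ r h
    · intro r x y _ _ h
      rw [mul_smul_comm]; exact Submodule.smul_mem _ r h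
  have hone : (1 : PolyT k) ∈ renQSym k δ := by
    rw [← hchar.nil]
    exact Submodule.subset_span ⟨[], rfl⟩
  exact ⟨(renQSym k δ).toSubalgebra hone fun x y hx hy => hmul x hx y hy, rfl⟩

end Birkhoff

end RenQuasiSym

end

theorem mainTheorem3 (k : Type*) [CommRing k] [Algebra ℚ k] :
    (∀ (δ δ' : ℕ+) (α : List ℕ), RenQuasiSym.renM k δ α = RenQuasiSym.renM k δ' α) ∧
    (∀ (δ : ℕ+) (α β : List ℕ),
      RenQuasiSym.renM k δ α * RenQuasiSym.renM k δ β =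
        Finsupp.linearCombination k (RenQuasiSym.renM k δ)
          (RenQuasiSym.quasiShuffle k α β)) ∧
    ∀ δ : ℕ+, ∃ S : Subalgebra k (RenQuasiSym.PolyT k),
      (S : Set (RenQuasiSym.PolyT k)) = RenQuasiSym.renQSym k δ :=
  ⟨RenQuasiSym.renM_eq_renM k,
    fun δ α β => by
      rw [RenQuasiSym.linearCombination_quasiShuffle, (RenQuasiSym.isStuffleChar_renM k δ).mul],
    RenQuasiSym.exists_subalgebra_renQSym k⟩
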